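/- Let $\mathcal{M}$ be an acyclic oriented matroid on a finite ground set $S$. A flat of $\mathcal{M}$ is the zero set $S \smallsetminus \underline{v^*}$ of a covector $v^*$, and a face of $\mathcal{M}$ is a set $F \subseteq S$ such that $(S \smallsetminus F, \varnothing)$ is a covector; in particular every face is a flat. Let $\mathrm{FL}(\mathcal{M})$ (the Las Vergnas face lattice) and $\mathrm{Flats}(\mathcal{M})$ be the lattices of faces and of flats, ordered by inclusion. For a finite lattice $L$ with bottom element $\hat 0$, an $L$-building set is a subset $B \subseteq L_{>\hat 0}$ such that for every $Y \in L_{>\hat 0}$, writing $\{B_1,\dots,B_k\}$ for the set of maximal elements of $B_{\le Y}$, there is an isomorphism of posets $\prod_{j} L_{\le B_j} \to L_{\le Y}$ whose $j$-th component is the inclusion $L_{\le B_j} \subseteq L_{\le Y}$. Let $\kappa(B)$ be the set of maximal elements of $B$. A nested set on $B$ is a set $N$ with $\kappa(B) \subseteq N \subseteq B$ such that for all $k \ge 2$ and all pairwise incomparable $B_1,\dots,B_k \in N \smallsetminus \kappa(B)$, the join $B_1 \vee \dots \vee B_k$ is not in $B$. The $L$-nested complex of $B$ is the simplicial complex whose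 faces are the sets $N \smallsetminus \kappa(B)$ for all nested sets $N$ on $B$. The $L$-building closure of a subset $X \subseteq L$ is the inclusion-minimum $L$-building set containing $X$. A facial (resp. flatial) building set for $\mathcal{M}$ is an $\mathrm{FL}(\mathcal{M})$-building set (resp. a $\mathrm{Flats}(\mathcal{M})$-building set), and its nested complex is called the facial (resp. flatial) nested complex. Then: 1. For every flatial building set $G$ for $\mathcal{M}$, the intersection $F = G \cap \mathrm{FL}(\mathcal{M})$ is a facial building set for $\mathcal{M}$, and the facial nested complex of $F$ is a subcomplex of the flatial nested complex of $G$. 2. If $\{s\}$ is a face of $\mathcal{M}$ for every $s \in S$, then for every facial building set $F$ for $\mathcal{M}$, the $\mathrm{Flats}(\mathcal{M})$-building closure $G$ of $F$ exists, satisfies $G \cap \mathrm{FL}(\mathcal{M}) = F$, and the facial nested complex of $F$ is a subcomplex of the flatial nested complex of $G$. -/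

import Mathlib

/-! ### Building sets and nested complexes on a lattice -/

section LatticePart

variable {L : Type*} [Lattice L] [OrderBot L]

/-- The maximal elements of `B` that lie below `Y`. -/
def maxBelow (B : Set L) (Y : L) : Set L :=
  {b | Maximal (fun x => x ∈ B ∧ x ≤ Y) b}

open Classical in
/-- `B ⊆ L_{> ⊥}` is a building set if for every `Y > ⊥` the lower interval of `Y` is the Cartesian
product of the lower intervals of the maximal elements of `B` below `Y`, through an isomorphism of
posets whose component at `j` is the inclusion of intervals (`Function.update ⊥ j X` is the
element of the product with entry `X` at `j` and entry `⊥` elsewhere). -/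
def IsBuildingSet (B : Set L) : Prop :=
  ⊥ ∉ B ∧ ∀ Y : L, Y ≠ ⊥ →
    ∃ φ : (∀ j : maxBelow B Y, Set.Iic (j : L)) ≃o Set.Iic Y,
      ∀ (j : maxBelow B Y) (X : Set.Iic (j : L)),
        (φ (Function.update ⊥ j X) : L) = (X : L)

/-- The connected components of `B`: its maximal elements. -/
def blockComponents (B : Set L) : Set L := {b | Maximal (· ∈ B) b}

/-- `N` is a nested set on `B`: it contains the connected components, and the join of any
`k ≥ 2` pairwise incomparable elements of `N` that are not components is not in `B`. -/
def IsNestedSet (B N : Set L) : Prop :=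
  N ⊆ B ∧ blockComponents B ⊆ N ∧
    ∀ A : Finset L, (A : Set L) ⊆ N \ blockComponents B → 2 ≤ A.card →
      IsAntichain (· ≤ ·) (A : Set L) → A.sup id ∉ B

/-- The nested complex of `B`: its faces are the sets `N \ κ(B)`, for `N` nested on `B` and `κ(B)`
the set of connected components (Mathlib does not list the empty face of a complex). -/
def nestedComplex (B : Set L) : PreAbstractSimplicialComplex L where
  faces := {σ | σ.Nonempty ∧ ∃ N : Set L, IsNestedSet B N ∧ (σ : Set L) = N \ blockComponents B}
  isRelLowerSet_faces := by
    rintro σ ⟨hσ, N, ⟨hNB, hκ, hA⟩, hσN⟩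
    refine ⟨hσ, fun τ hτσ hτ => ⟨hτ, (τ : Set L) ∪ blockComponents B, ⟨?_, ?_, ?_⟩, ?_⟩⟩
    · rintro x (hx | hx)
      · have hx' : x ∈ (σ : Set L) := hτσ hx
        rw [hσN] at hx'
        exact hNB hx'.1
      · exact hx.1
    · exact Set.subset_union_right
    · intro A hAτ hcard hanti
      refine hA A (fun x hx => ?_) hcard hanti
      have hxτ := hAτ hx
      have hx' : x ∈ (σ : Set L) := hτσ (hxτ.1.resolve_right hxτ.2)
      rwa [hσN] at hx'
    · ext x
      constructor
      · intro hx
        have hx' : x ∈ (σ : Set L) := hτσ hx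
        rw [hσN] at hx'
        exact ⟨Or.inl hx, hx'.2⟩
      · rintro ⟨hx, hx'⟩
        exact hx.resolve_right hx'

/-- The building closure of `X`: the intersection of all building sets that contain `X`. -/
def buildingClosure (X : Set L) : Set L :=
  ⋂₀ {B | IsBuildingSet B ∧ X ⊆ B}

end LatticePart

/-! ### Oriented matroids -/

/-- Two signed subsets are sign orthogonal: there is an element on which they agree in sign
if and only if there is an element on which they have opposite signs. -/
def SignOrthogonal {S : Type*} (x y : S → SignType) : Prop :=
  (∃ s, x s * y s = 1) ↔ (∃ s, x s * y s = -1)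

/-- The signed subsets that are sign orthogonal to all members of `X`. -/
def signPerp {S : Type*} (X : Set (S → SignType)) : Set (S → SignType) :=
  {y | ∀ x ∈ X, SignOrthogonal x y}

/-- The nonzero members of `X` whose support is minimal among nonzero members of `X`. -/
def suppMin {S : Type*} (X : Set (S → SignType)) : Set (S → SignType) :=
  {x | x ∈ X ∧ x ≠ 0 ∧ ∀ y ∈ X, y ≠ 0 → Function.support y ⊆ Function.support x →
    Function.support y = Function.support x}

/-- An oriented matroid on the ground set `S`. A signed subset `(x₊, x₋)` of `S` is encoded by the
function that is `1` on `x₊`, `-1` on `x₋` and `0` elsewhere. -/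
structure OrientedMatroid (S : Type*) where
  vectors : Set (S → SignType)
  covectors : Set (S → SignType)
  circuits : Set (S → SignType)
  cocircuits : Set (S → SignType)
  vectors_eq : vectors = signPerp cocircuits
  covectors_eq : covectors = signPerp circuits
  circuits_eq : circuits = suppMin vectors
  cocircuits_eq : cocircuits = suppMin covectors
  zero_notMem : (0 : S → SignType) ∉ circuits
  neg_mem : ∀ c ∈ circuits, -c ∈ circuits
  eq_or_eq_neg : ∀ c ∈ circuits, ∀ c' ∈ circuits,
    Function.support c ⊆ Function.support c' → c = c' ∨ c = -c'
  elimination : ∀ c ∈ circuits, ∀ c' ∈ circuits, c ≠ -c' → ∀ s, c s = 1 → c' s = -1 →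
    ∃ c'' ∈ circuits,
      (∀ t, c'' t = 1 → (c t = 1 ∨ c' t = 1) ∧ t ≠ s) ∧
      (∀ t, c'' t = -1 → (c t = -1 ∨ c' t = -1) ∧ t ≠ s)

namespace OrientedMatroid

variable {S : Type*} (M : OrientedMatroid S)

/-- There is no positive circuit. -/
def IsAcyclic : Prop := ¬ ∃ c ∈ M.circuits, ∀ s, 0 ≤ c s

/-- `F` is a face: `(S \ F, ∅)` is a covector. -/
def IsFace (F : Set S) : Prop :=
  ∃ x ∈ M.covectors, (∀ s, 0 ≤ x s) ∧ F = {s | x s = 0}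

/-- `F` is a flat: it is the zero set of a covector. -/
def IsFlat (F : Set S) : Prop :=
  ∃ x ∈ M.covectors, F = {s | x s = 0}

/-- The (Las Vergnas) face lattice: the faces ordered by inclusion. -/
def FaceLattice : Type _ := {F : Set S // M.IsFace F}

/-- The flat lattice: the flats ordered by inclusion. -/
def FlatLattice : Type _ := {F : Set S // M.IsFlat F}

instance : PartialOrder M.FaceLattice := inferInstanceAs (PartialOrder {F : Set S // M.IsFace F})

instance : PartialOrder M.FlatLattice := inferInstanceAs (PartialOrder {F : Set S // M.IsFlat F})

/-- The inclusion of the face lattice into the flat lattice. -/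
def faceToFlat : M.FaceLattice ↪o M.FlatLattice where
  toFun F := ⟨F.1, by obtain ⟨x, hx, -, h⟩ := F.2; exact ⟨x, hx, h⟩⟩
  inj' := fun F F' h => Subtype.ext (Subtype.mk.inj h)
  map_rel_iff' := Iff.rfl

variable {M}

/-- The composition of two covectors is a covector. -/
lemma comp_mem_covectors {x y : S → SignType} (hx : x ∈ M.covectors) (hy : y ∈ M.covectors) :
    (fun s => if x s = 0 then y s else x s) ∈ M.covectors := by
  rw [M.covectors_eq] at hx hy ⊢
  intro c hc
  have h1 := hx c hc
  have h2 := hy c hc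
  unfold SignOrthogonal at h1 h2 ⊢
  by_cases h : ∀ s, c s * x s = 0
  · have key : ∀ s, c s * (if x s = 0 then y s else x s) = c s * y s := by
      intro s
      split_ifs with h0
      · rfl
      · rcases mul_eq_zero.1 (h s) with h' | h'
        · simp [h']
        · exact absurd h' h0
    simp only [key]
    exact h2
  · have key : ∀ e : SignType, e ≠ 0 → (∃ s, c s * x s = e) →
        ∃ s, c s * (if x s = 0 then y s else x s) = e := by
      rintro e he ⟨s, hs⟩
      refine ⟨s, ?_⟩
      have : x s ≠ 0 := by
        intro h0
        rw [h0, mul_zero] at hs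
        exact he hs.symm
      rw [if_neg this]
      exact hs
    have h3 : (∃ s, c s * x s = 1) ∨ (∃ s, c s * x s = -1) := by
      push Not at h
      obtain ⟨s, hs⟩ := h
      rcases SignType.trichotomy (c s * x s) with h' | h' | h'
      · exact Or.inr ⟨s, h'⟩
      · exact absurd h' hs
      · exact Or.inl ⟨s, h'⟩
    have hp : ∃ s, c s * x s = 1 := h3.elim id h1.2
    exact ⟨fun _ => key _ (by decide) (h1.1 hp), fun _ => key _ (by decide) hp⟩

lemma zero_mem_covectors : (0 : S → SignType) ∈ M.covectors := by
  rw [M.covectors_eq]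
  intro c _
  simp [SignOrthogonal]

lemma IsFlat.univ : M.IsFlat Set.univ := ⟨0, zero_mem_covectors, by simp⟩

lemma IsFace.univ : M.IsFace Set.univ := ⟨0, zero_mem_covectors, by simp, by simp⟩

lemma IsFlat.inter {F F' : Set S} (hF : M.IsFlat F) (hF' : M.IsFlat F') : M.IsFlat (F ∩ F') := by
  obtain ⟨x, hx, rfl⟩ := hF
  obtain ⟨y, hy, rfl⟩ := hF'
  refine ⟨_, comp_mem_covectors hx hy, ?_⟩
  ext s
  by_cases h : x s = 0 <;> simp [h]

lemma IsFace.inter {F F' : Set S} (hF : M.IsFace F) (hF' : M.IsFace F') : M.IsFace (F ∩ F') := by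
  obtain ⟨x, hx, hx0, rfl⟩ := hF
  obtain ⟨y, hy, hy0, rfl⟩ := hF'
  refine ⟨_, comp_mem_covectors hx hy, fun s => ?_, ?_⟩
  · split_ifs
    · exact hy0 s
    · exact hx0 s
  · ext s
    by_cases h : x s = 0 <;> simp [h]

/-- On a finite set, a family closed under binary intersections and containing the whole set is
closed under arbitrary intersections. -/
lemma sInter_closed [Finite S] {P : Set S → Prop} (huniv : P Set.univ)
    (hinter : ∀ F F', P F → P F' → P (F ∩ F')) (𝒜 : Set (Set S)) (h : ∀ F ∈ 𝒜, P F) :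
    P (⋂₀ 𝒜) := by
  induction 𝒜, Set.toFinite 𝒜 using Set.Finite.induction_on with
  | empty => simpa using huniv
  | insert _ _ ih =>
    rw [Set.sInter_insert]
    exact hinter _ _ (h _ (Set.mem_insert _ _)) (ih fun F hF => h F (Set.mem_insert_of_mem _ hF))

variable (M)

instance [Finite S] : InfSet M.FaceLattice where
  sInf 𝒜 := ⟨⋂₀ (Subtype.val '' 𝒜), sInter_closed IsFace.univ (fun _ _ => IsFace.inter) _ (by
    rintro _ ⟨F, -, rfl⟩
    exact F.2)⟩

instance [Finite S] : InfSet M.FlatLattice where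
  sInf 𝒜 := ⟨⋂₀ (Subtype.val '' 𝒜), sInter_closed IsFlat.univ (fun _ _ => IsFlat.inter) _ (by
    rintro _ ⟨F, -, rfl⟩
    exact F.2)⟩

/-- The meet is the intersection, the join is the smallest face containing the union. -/
noncomputable instance [Finite S] : CompleteLattice M.FaceLattice :=
  completeLatticeOfInf _ fun 𝒜 =>
    ⟨fun F hF => Set.sInter_subset_of_mem (Set.mem_image_of_mem Subtype.val hF),
      fun F hF => Set.subset_sInter (by
        rintro _ ⟨F', hF', rfl⟩
        exact hF hF')⟩

/-- The meet is the intersection, the join is the smallest flat containing the union. -/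
noncomputable instance [Finite S] : CompleteLattice M.FlatLattice :=
  completeLatticeOfInf _ fun 𝒜 =>
    ⟨fun F hF => Set.sInter_subset_of_mem (Set.mem_image_of_mem Subtype.val hF),
      fun F hF => Set.subset_sInter (by
        rintro _ ⟨F', hF', rfl⟩
        exact hF hF')⟩

end OrientedMatroid

/-!
A product decomposition of a lower interval, in the lattice of flats or in the face lattice, is read
as a splitting of the oriented matroid: the ground set of the interval is the disjoint union of the
parts, and every circuit inside it lies inside one part (`OrientedMatroid.Splits`).

For flats the two notions agree. A circuit through an element `e` of a part `B` puts `e` in the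
closure of its other elements; in a product only those inside `B` matter, so minimality of circuits
forces the circuit into `B` (`IsAcyclic.splits_of_isProductAt_flat`). Conversely, unions of flats of
the parts are flats. The same holds for faces (`Splits.isProductAt_face`), and the parts of a split
face are themselves faces because `∅` is a face (`Splits.isFace`). So the blocks of a flatial
building set `G` below a face are faces, which shows that the faces in `G` form a building set. If a
join of faces taken in the lattice of flats belongs to `G`, it lies in a block below their join `Y`
in the face lattice; the block is a face, so it equals `Y` and belongs to `G`. This compares the
nested sets.

A product decomposition in the face lattice is a splitting when the singletons are faces
(`IsAcyclic.splits_of_isProductAt_face`). The point is that two elements added by a cover of faces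
are parallel modulo the smaller face (`exists_circuit_of_covBy`); along a maximal chain of faces, a
circuit meeting two parts could be shortened by elimination.

Splittings also show that building sets of flats are the sets of nonempty flats that contain the
closures of elements and of circuits and are closed under joins of intersecting members
(`IsAcyclic.isBuildingSet_flat_iff`). Hence they are stable under intersection, so the building
closure of a facial building set `F` exists. It contains no further face, because the flats that lie
in a single block of every face containing them form a building set whose faces are those of `F`
(`blockFlats`).

These arguments rest on two facts about circuits that are derived from the circuit axioms: strong
elimination (`IsCircuitSystem.strong_elimination`, by induction through contractions) and the
painting lemma (`IsCircuitSystem.painting`), which provides all covectors that are needed.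
-/

/-! ### Circuit systems and contraction -/

namespace SignType

lemma eq_neg_of_ne {a b : SignType} (ha : a ≠ 0) (hb : b ≠ 0) (h : a ≠ b) : a = -b := by
  revert a b; decide

lemma pi_neg_eq_zero {S : Type*} {x : S → SignType} : -x = 0 ↔ x = 0 := by
  simp [funext_iff]

lemma support_neg {S : Type*} (x : S → SignType) :
    Function.support (-x) = Function.support x := by
  ext t
  simp

lemma ne_neg_self {a : SignType} (ha : a ≠ 0) : a ≠ -a := by
  revert a; decide

end SignType

section CircuitSystem

variable {S : Type*}

/-- The circuit axioms of an oriented matroid, with elimination stated symmetrically in the two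
signs. -/
structure IsCircuitSystem (C : Set (S → SignType)) : Prop where
  zero_notMem : (0 : S → SignType) ∉ C
  neg_mem : ∀ c ∈ C, -c ∈ C
  eq_or_eq_neg : ∀ c ∈ C, ∀ c' ∈ C,
    Function.support c ⊆ Function.support c' → c = c' ∨ c = -c'
  elimination : ∀ c ∈ C, ∀ c' ∈ C, c ≠ -c' → ∀ s, c s ≠ 0 → c' s = -c s →
    ∃ d ∈ C, d s = 0 ∧ ∀ t, d t ≠ 0 → d t = c t ∨ d t = c' t

lemma OrientedMatroid.isCircuitSystem (M : OrientedMatroid S) : IsCircuitSystem M.circuits where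
  zero_notMem := M.zero_notMem
  neg_mem := M.neg_mem
  eq_or_eq_neg := M.eq_or_eq_neg
  elimination := by
    have key : ∀ c ∈ M.circuits, ∀ c' ∈ M.circuits, c ≠ -c' → ∀ s, c s = 1 → c' s = -1 →
        ∃ d ∈ M.circuits, d s = 0 ∧ ∀ t, d t ≠ 0 → d t = c t ∨ d t = c' t := by
      intro c hc c' hc' hne s h1 h2
      obtain ⟨d, hd, hp, hn⟩ := M.elimination c hc c' hc' hne s h1 h2
      refine ⟨d, hd, ?_, fun t ht => ?_⟩
      · rcases SignType.trichotomy (d s) with h | h | h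
        · exact absurd rfl (hn s h).2
        · exact h
        · exact absurd rfl (hp s h).2
      · rcases SignType.trichotomy (d t) with h | h | h
        · rcases (hn t h).1 with h' | h' <;> simp [h, h']
        · exact absurd h ht
        · rcases (hp t h).1 with h' | h' <;> simp [h, h']
    intro c hc c' hc' hne s h1 h2
    rcases SignType.trichotomy (c s) with h | h | h
    · obtain ⟨d, hd, hd0, hdt⟩ := key c' hc' c hc (fun h' => hne (by rw [h', neg_neg])) s
        (by rw [h2, h]; rfl) h
      exact ⟨d, hd, hd0, fun t ht => (hdt t ht).symm⟩
    · exact absurd h h1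
    · exact key c hc c' hc' hne s h (by rw [h2, h])

open Classical in
/-- The sign vector `c` with its entry at `a` replaced by `0`. -/
noncomputable def zeroAt (a : S) (c : S → SignType) : S → SignType :=
  fun t => if t = a then 0 else c t

lemma zeroAt_self (a : S) (c : S → SignType) : zeroAt a c a = 0 := by simp [zeroAt]

lemma zeroAt_of_ne {a t : S} (h : t ≠ a) (c : S → SignType) : zeroAt a c t = c t := by
  simp [zeroAt, h]

lemma zeroAt_eq_of_ne_zero {a t : S} {c : S → SignType} (h : zeroAt a c t ≠ 0) :
    t ≠ a ∧ zeroAt a c t = c t := by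
  by_cases hta : t = a
  · subst hta; exact absurd (zeroAt_self _ _) h
  · exact ⟨hta, zeroAt_of_ne hta c⟩

/-- The circuits of the contraction by `a`, as sign vectors on the same ground set that vanish
at `a`. -/
def contractAt (a : S) (C : Set (S → SignType)) : Set (S → SignType) := suppMin (zeroAt a '' C)

/-- A circuit that does not remain minimal after the deletion of `a` is covered by conformal
circuits through `a`. The circuits `d₁` and `d₂` with opposite signs at `a` cover it because the
elimination of `a` between them can only return the circuit itself. -/
lemma IsCircuitSystem.exists_conformal_smaller [Finite S] {C : Set (S → SignType)}
    (hC : IsCircuitSystem C) {a h : S} {c c' : S → SignType} (hc : c ∈ C) (hc' : c' ∈ C)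
    (hh : c h ≠ 0) (hc'0 : zeroAt a c' ≠ 0)
    (hsub : Function.support (zeroAt a c') ⊂ Function.support (zeroAt a c)) :
    ∃ d ∈ C, d h = c h ∧ (∀ t, t ≠ a → d t ≠ 0 → d t = c t) ∧
      Function.support (zeroAt a d) ⊂ Function.support (zeroAt a c) := by
  have hsub' : ∀ t, t ≠ a → c' t ≠ 0 → c t ≠ 0 := fun t hta ht => by
    have := hsub.1 (show t ∈ Function.support (zeroAt a c') by
      rwa [Function.mem_support, zeroAt_of_ne hta])
    rwa [Function.mem_support, zeroAt_of_ne hta] at this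
  have hnot : ¬ Function.support c' ⊆ Function.support c := by
    intro hle
    have hEq : Function.support c' = Function.support c := by
      rcases hC.eq_or_eq_neg c' hc' c hc hle with rfl | rfl
      · rfl
      · rw [SignType.support_neg]
    refine hsub.2 fun t ht => ?_
    obtain ⟨hta, h2⟩ := zeroAt_eq_of_ne_zero ht
    have : t ∈ Function.support c := by
      rw [Function.mem_support, ← h2]; exact ht
    rw [← hEq] at this
    rwa [Function.mem_support, zeroAt_of_ne hta]
  have hca : c a = 0 := by
    by_contra hca
    refine hnot fun t ht => ?_
    by_cases hta : t = a
    · subst hta; exact hca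
    · exact hsub' t hta ht
  have hc'a : c' a ≠ 0 := by
    intro h0
    refine hnot fun t ht => hsub' t ?_ ht
    rintro rfl
    exact ht h0
  -- circuits inside `supp c ∪ {a}` other than `±c` use `a`
  have use_a : ∀ d ∈ C, (∀ t, t ≠ a → d t ≠ 0 → c t ≠ 0) → (∃ t, c t ≠ 0 ∧ d t = 0) →
      d a ≠ 0 := by
    rintro d hd hdc ⟨t, ht, hdt⟩ hda
    rcases hC.eq_or_eq_neg d hd c hc (fun u hu => hdc u (by rintro rfl; exact hu hda) hu)
      with rfl | rfl
    · exact ht hdt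
    · exact ht (by simpa using hdt)
  -- eliminating the elements of `d` with the wrong sign against `c` keeps the sign at `a`
  have conf : ∀ n : ℕ, ∀ d ∈ C, {t | t ≠ a ∧ d t ≠ 0 ∧ d t ≠ c t}.ncard = n →
      (∀ t, t ≠ a → d t ≠ 0 → c t ≠ 0) → d a ≠ 0 →
      ∃ d' ∈ C, d' a = d a ∧ ∀ t, t ≠ a → d' t ≠ 0 → d' t = c t := by
    intro n
    induction n using Nat.strong_induction_on with
    | _ n ih =>
      intro d hd hn hdc hda
      by_cases hex : ∃ t, t ≠ a ∧ d t ≠ 0 ∧ d t ≠ c t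
      · obtain ⟨t, hta, ht, htc⟩ := hex
        have hct := hdc t hta ht
        have hdt : d t = -c t := SignType.eq_neg_of_ne ht hct htc
        obtain ⟨e, he, het, hes⟩ := hC.elimination c hc d hd (by
          rintro h; rw [h] at hca; exact hda (by simpa using hca)) t hct hdt
        have hec : ∀ u, u ≠ a → e u ≠ 0 → c u ≠ 0 := fun u hua hu h0 => by
          rcases hes u hu with h | h
          · exact hu (h.trans h0)
          · exact hdc u hua (h ▸ hu) h0
        have hea : e a ≠ 0 := use_a e he hec ⟨t, hct, het⟩
        have hea' : e a = d a := by
          rcases hes a hea with h | h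
          · exact absurd (h.trans hca) hea
          · exact h
        obtain ⟨d', hd', h1, h2⟩ := ih _ (by
          rw [← hn]
          refine Set.ncard_lt_ncard (Set.ssubset_iff_exists.2 ⟨?_, t, ⟨hta, ht, htc⟩, ?_⟩)
            (Set.toFinite _)
          · rintro u ⟨hua, hu, huc⟩
            have := (hes u hu).resolve_left huc
            exact ⟨hua, this ▸ hu, this ▸ huc⟩
          · rintro ⟨-, h, -⟩
            exact h het) e he rfl hec hea
        exact ⟨d', hd', h1.trans hea', h2⟩
      · push Not at hex
        exact ⟨d, hd, rfl, hex⟩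
  have ha' : ∀ t, c t ≠ 0 → t ≠ a := by
    rintro t ht rfl
    exact ht hca
  have fin : ∀ d ∈ C, d a ≠ 0 → (∀ t, t ≠ a → d t ≠ 0 → d t = c t) → d h ≠ 0 →
      ∃ d ∈ C, d h = c h ∧ (∀ t, t ≠ a → d t ≠ 0 → d t = c t) ∧
      Function.support (zeroAt a d) ⊂ Function.support (zeroAt a c) := by
    intro d hd hda hconf hdh
    refine ⟨d, hd, hconf h (ha' h hh) hdh, hconf, fun t ht => ?_, fun hle => ?_⟩
    · obtain ⟨hta, h2⟩ := zeroAt_eq_of_ne_zero ht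
      rw [Function.mem_support, h2] at ht
      rw [Function.mem_support, zeroAt_of_ne hta, ← hconf t hta ht]
      exact ht
    · rcases hC.eq_or_eq_neg c hc d hd (fun t ht => by
        have := hle (show t ∈ Function.support (zeroAt a c) by
          rwa [Function.mem_support, zeroAt_of_ne (ha' t ht)])
        rwa [Function.mem_support, zeroAt_of_ne (ha' t ht)] at this) with rfl | rfl
      · exact hda hca
      · exact hda (by simpa using hca)
  obtain ⟨d₁, hd₁, h1a, h1⟩ := conf _ c' hc' rfl hsub' hc'a
  have h1a' : d₁ a ≠ 0 := h1a ▸ hc'a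
  by_cases h1h : d₁ h = 0
  swap
  · exact fin d₁ hd₁ h1a' h1 h1h
  obtain ⟨d₂, hd₂, h2a, h2⟩ := conf _ (-d₁) (hC.neg_mem _ hd₁) rfl
    (fun t hta ht => by
      have ht' : d₁ t ≠ 0 := by simpa using ht
      rw [← h1 t hta ht']; exact ht') (by simpa using h1a')
  have h2a' : d₂ a = -d₁ a := h2a
  have h2a0 : d₂ a ≠ 0 := by rw [h2a']; simpa using h1a'
  refine fin d₂ hd₂ h2a0 h2 fun h2h => ?_
  have hne : d₁ ≠ -d₂ := by
    intro heq
    -- `d₁` is not the loop `a`, as `c'` contains `a` and a further element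
    obtain ⟨k, hka, hk⟩ : ∃ k, k ≠ a ∧ d₁ k ≠ 0 := by
      by_contra hcon
      push Not at hcon
      refine hc'0 (funext fun t => ?_)
      rcases hC.eq_or_eq_neg d₁ hd₁ c' hc' (fun t ht => by
        by_cases hta : t = a
        · subst hta; exact hc'a
        · exact absurd (hcon t hta) ht) with rfl | h'
      · by_cases hta : t = a
        · subst hta; exact zeroAt_self _ _
        · rw [zeroAt_of_ne hta]; exact hcon t hta
      · by_cases hta : t = a
        · subst hta; exact zeroAt_self _ _
        · rw [zeroAt_of_ne hta]
          have := hcon t hta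
          rw [h'] at this
          simpa using this
    have e1 := h1 k hka hk
    have e3 : d₁ k = -d₂ k := congrFun heq k
    have e2 := h2 k hka (by intro h0; rw [h0] at e3; exact hk (by simpa using e3))
    rw [e2, ← e1] at e3
    exact SignType.ne_neg_self hk e3
  obtain ⟨e, he, hea, hes⟩ := hC.elimination d₁ hd₁ d₂ hd₂ hne a h1a' h2a'
  have heh : e h = 0 := by
    by_contra h0
    rcases hes h h0 with h' | h'
    · exact h0 (h'.trans h1h)
    · exact h0 (h'.trans h2h)
  refine use_a e he (fun t hta ht => ?_) ⟨h, hh, heh⟩ hea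
  rcases hes t ht with h' | h' <;> rw [h'] at ht
  · rw [← h1 t hta ht]; exact ht
  · rw [← h2 t hta ht]; exact ht

/-- A circuit is, away from `a`, covered by conformal circuits of the contraction by `a`. -/
lemma IsCircuitSystem.exists_contractAt_conformal [Finite S] {C : Set (S → SignType)}
    (hC : IsCircuitSystem C) (a : S) {h : S} (hha : h ≠ a) {c : S → SignType} (hc : c ∈ C)
    (hh : c h ≠ 0) :
    ∃ d ∈ contractAt a C, d h = c h ∧ ∀ t, d t ≠ 0 → d t = c t := by
  induction hn : (Function.support (zeroAt a c)).ncard using Nat.strong_induction_on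
    generalizing c with
  | _ n ih =>
    have hc0 : zeroAt a c ≠ 0 := fun h0 => hh (by rw [← zeroAt_of_ne hha c, h0]; rfl)
    by_cases hmin : zeroAt a c ∈ contractAt a C
    · exact ⟨_, hmin, zeroAt_of_ne hha c, fun t ht => (zeroAt_eq_of_ne_zero ht).2⟩
    · have : ∃ c' ∈ C, zeroAt a c' ≠ 0 ∧
          Function.support (zeroAt a c') ⊂ Function.support (zeroAt a c) := by
        by_contra hcon
        push Not at hcon
        refine hmin ⟨⟨c, hc, rfl⟩, hc0, ?_⟩
        rintro _ ⟨c', hc', rfl⟩ h0 hle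
        by_contra hne
        exact hcon c' hc' h0 (lt_of_le_of_ne hle hne)
      obtain ⟨c', hc', h0, hlt⟩ := this
      obtain ⟨d, hd, hdh, hconf, hlt'⟩ := hC.exists_conformal_smaller hc hc' hh h0 hlt
      obtain ⟨e, he, heh, hes⟩ := ih _ (hn ▸ Set.ncard_lt_ncard hlt' (Set.toFinite _)) hd
        (by rwa [hdh]) rfl
      refine ⟨e, he, heh.trans hdh, fun t ht => ?_⟩
      have hta : t ≠ a := by
        rintro rfl
        obtain ⟨⟨e', -, rfl⟩, -⟩ := he
        exact ht (zeroAt_self _ _)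
      have h1 := hes t ht
      rw [h1]
      exact hconf t hta (h1 ▸ ht)

lemma IsCircuitSystem.contractAt [Finite S] {C : Set (S → SignType)} (hC : IsCircuitSystem C)
    (a : S) : IsCircuitSystem (contractAt a C) := by
  have zneg : ∀ c : S → SignType, zeroAt a (-c) = -zeroAt a c := fun c => by
    funext t
    by_cases hta : t = a <;> simp [zeroAt, hta]
  -- a circuit of `C` met during an elimination is not the loop `a`
  have nonzero : ∀ c ∈ C, ∀ c' ∈ C, ∀ d ∈ C, zeroAt a c ≠ 0 → zeroAt a c' ≠ 0 →
      (∀ t, d t ≠ 0 → d t = c t ∨ d t = c' t) → zeroAt a d ≠ 0 := by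
    intro c hc c' hc' d hd h0 h0' hs hd0
    have hz : ∀ t, t ≠ a → d t = 0 := fun t hta => by
      rw [← zeroAt_of_ne hta d, hd0]; rfl
    have hda : d a ≠ 0 := by
      intro hda
      refine hC.zero_notMem ?_
      convert hd
      funext t
      by_cases hta : t = a
      · rw [hta]; exact hda.symm
      · exact (hz t hta).symm
    have aux : ∀ e ∈ C, zeroAt a e ≠ 0 → d a ≠ e a := by
      intro e he he0 h
      have hle : Function.support d ⊆ Function.support e := fun t ht => by
        by_cases hta : t = a
        · rw [hta, Function.mem_support, ← h]; exact hda
        · exact absurd (hz t hta) ht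
      rcases hC.eq_or_eq_neg d hd e he hle with h' | h'
      · exact he0 (h' ▸ hd0)
      · rw [h', zneg] at hd0
        exact he0 (SignType.pi_neg_eq_zero.1 hd0)
    rcases hs a hda with h | h
    · exact aux c hc h0 h
    · exact aux c' hc' h0' h
  refine ⟨fun h => h.2.1 rfl, ?_, ?_, ?_⟩
  · rintro _ ⟨⟨c, hc, rfl⟩, h0, hmin⟩
    refine ⟨⟨-c, hC.neg_mem c hc, zneg c⟩, fun h => h0 (SignType.pi_neg_eq_zero.1 h), ?_⟩
    rwa [SignType.support_neg]
  · rintro _ ⟨⟨c, hc, rfl⟩, h0, hmin⟩ _ ⟨⟨c', hc', rfl⟩, h0', hmin'⟩ hle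
    have hEq := hmin' _ ⟨c, hc, rfl⟩ h0 hle
    by_contra hcon
    push Not at hcon
    obtain ⟨u, hu⟩ := Function.ne_iff.1 hcon.1
    obtain ⟨v, hv⟩ := Function.ne_iff.1 hcon.2
    have nz : ∀ t, zeroAt a c t ≠ 0 ↔ zeroAt a c' t ≠ 0 := fun t => Set.ext_iff.1 hEq t
    have hu0 : zeroAt a c u ≠ 0 := by
      intro h
      have h' : zeroAt a c' u = 0 := by_contra fun h' => (nz u).2 h' h
      exact hu (h.trans h'.symm)
    have hv0 : zeroAt a c v ≠ 0 := by
      intro h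
      have h' : zeroAt a c' v = 0 := by_contra fun h' => (nz v).2 h' h
      exact hv (by rw [Pi.neg_apply, h, h']; rfl)
    obtain ⟨hua, hu1⟩ := zeroAt_eq_of_ne_zero hu0
    obtain ⟨hva, hv1⟩ := zeroAt_eq_of_ne_zero hv0
    have hu2 := zeroAt_of_ne hua c'
    have hv2 := zeroAt_of_ne hva c'
    have hcu : c' u = -c u := by
      rw [← hu1, ← hu2]
      exact SignType.eq_neg_of_ne ((nz u).1 hu0) hu0 (Ne.symm hu)
    have hne : c ≠ -c' := by
      intro h
      apply hv
      rw [Pi.neg_apply, hv1, hv2, h]; rfl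
    obtain ⟨d, hd, hdu, hds⟩ := hC.elimination c hc c' hc' hne u (hu1 ▸ hu0) hcu
    have hd0 := nonzero c hc c' hc' d hd h0 h0' hds
    have := hmin _ ⟨d, hd, rfl⟩ hd0 (fun t ht => by
      obtain ⟨hta, ht1⟩ := zeroAt_eq_of_ne_zero ht
      rw [Function.mem_support, ht1] at ht
      rcases hds t ht with h | h
      · rw [Function.mem_support, zeroAt_of_ne hta, ← h]; exact ht
      · rw [Function.mem_support, nz, zeroAt_of_ne hta, ← h]; exact ht)
    have hmem : u ∈ Function.support (zeroAt a d) := by rw [this]; exact hu0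
    rw [Function.mem_support, zeroAt_of_ne hua] at hmem
    exact hmem hdu
  · rintro _ ⟨⟨c, hc, rfl⟩, h0, hmin⟩ _ ⟨⟨c', hc', rfl⟩, h0', hmin'⟩ hne s hs hs'
    obtain ⟨hsa, hs1⟩ := zeroAt_eq_of_ne_zero hs
    rw [hs1] at hs
    rw [hs1, zeroAt_of_ne hsa] at hs'
    obtain ⟨d, hd, hds, hdt⟩ := hC.elimination c hc c' hc'
      (fun h => hne (by rw [h, zneg])) s hs hs'
    obtain ⟨h, hh⟩ := Function.ne_iff.1 (nonzero c hc c' hc' d hd h0 h0' hdt)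
    obtain ⟨hha, hh1⟩ := zeroAt_eq_of_ne_zero hh
    obtain ⟨e, he, -, hes⟩ := hC.exists_contractAt_conformal a hha hd (hh1 ▸ hh)
    refine ⟨e, he, by_contra fun hes0 => hes0 ((hes s hes0).trans hds), fun t ht => ?_⟩
    have hta : t ≠ a := by
      rintro rfl
      obtain ⟨⟨e', -, rfl⟩, -⟩ := he
      exact ht (zeroAt_self _ _)
    rw [zeroAt_of_ne hta, zeroAt_of_ne hta, hes t ht]
    exact hdt t (hes t ht ▸ ht)

/-- Strong elimination: a prescribed element `f` can be kept. The induction on the size of the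
union of the two supports passes to the contraction by an element `a` of a weakly eliminated
circuit `Z₀` that misses `f`; the resulting circuit may have the wrong sign at `a`, and then `a`
is eliminated between it and `Z₀`. -/
theorem IsCircuitSystem.strong_elimination [Finite S] {C : Set (S → SignType)}
    (hC : IsCircuitSystem C) {X Y : S → SignType} (hX : X ∈ C) (hY : Y ∈ C) {e f : S}
    (he : X e ≠ 0) (heY : Y e = -X e) (hf : X f ≠ 0) (hfY : Y f ≠ -X f) :
    ∃ Z ∈ C, Z e = 0 ∧ Z f = X f ∧ ∀ t, Z t ≠ 0 → Z t = X t ∨ Z t = Y t := by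
  induction hn : (Function.support X ∪ Function.support Y).ncard using Nat.strong_induction_on
    generalizing C X Y e with
  | _ n ih =>
    have hne : X ≠ -Y := by
      rintro rfl
      exact hfY (by simp)
    obtain ⟨Z₀, hZ₀, hZ₀e, hZ₀s⟩ := hC.elimination X hX Y hY hne e he heY
    by_cases hZ₀f : Z₀ f = 0
    swap
    · refine ⟨Z₀, hZ₀, hZ₀e, ?_, hZ₀s⟩
      rcases hZ₀s f hZ₀f with h | h
      · exact h
      · by_contra h'
        exact hfY (h ▸ SignType.eq_neg_of_ne hZ₀f hf h')
    obtain ⟨a, ha⟩ : ∃ a, Z₀ a ≠ 0 := by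
      by_contra hcon
      push Not at hcon
      exact hC.zero_notMem (by convert hZ₀; exact (funext hcon).symm)
    have hae : e ≠ a := by rintro rfl; exact ha hZ₀e
    have haf : f ≠ a := by rintro rfl; exact ha hZ₀f
    have haXY : a ∈ Function.support X ∪ Function.support Y := by
      rcases hZ₀s a ha with h | h
      · exact Or.inl (h.symm.trans_ne ha)
      · exact Or.inr (h.symm.trans_ne ha)
    have cont : ∀ c ∈ _root_.contractAt a C, c a = 0 := by
      rintro _ ⟨⟨e', -, rfl⟩, -⟩
      exact zeroAt_self _ _
    obtain ⟨X', hX', hX'f, hX's⟩ := hC.exists_contractAt_conformal a haf hX hf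
    have step : ∃ Z' ∈ _root_.contractAt a C, Z' e = 0 ∧ Z' f = X f ∧
        ∀ t, Z' t ≠ 0 → Z' t = X t ∨ Z' t = Y t := by
      by_cases hX'e : X' e = 0
      · exact ⟨X', hX', hX'e, hX'f, fun t ht => Or.inl (hX's t ht)⟩
      · have hYe : Y e ≠ 0 := by rw [heY]; simpa using he
        obtain ⟨Y', hY', hY'e, hY's⟩ := hC.exists_contractAt_conformal a hae hY hYe
        obtain ⟨Z', hZ', h1, h2, h3⟩ := ih _ (by
            rw [← hn]
            refine Set.ncard_lt_ncard (Set.ssubset_iff_exists.2 ⟨?_, a, haXY, ?_⟩)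
              (Set.toFinite _)
            · rintro t (ht | ht)
              · exact Or.inl ((hX's t ht).symm.trans_ne ht)
              · exact Or.inr ((hY's t ht).symm.trans_ne ht)
            · rintro (h | h)
              · exact h (cont _ hX')
              · exact h (cont _ hY')) (hC.contractAt a) hX' hY' hX'e
            (by rw [hY'e, hX's e hX'e, heY]) (hX'f ▸ hf) (by
              intro h
              rw [hX'f] at h
              have : Y' f ≠ 0 := by rw [h]; simpa using hf
              exact hfY (hY's f this ▸ h)) rfl
        refine ⟨Z', hZ', h1, h2.trans hX'f, fun t ht => ?_⟩
        rcases h3 t ht with h | h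
        · exact Or.inl (h.trans (hX's t (h ▸ ht)))
        · exact Or.inr (h.trans (hY's t (h ▸ ht)))
    obtain ⟨_, ⟨⟨Z, hZ, rfl⟩, -⟩, hZe, hZf, hZs⟩ := step
    rw [zeroAt_of_ne hae] at hZe
    rw [zeroAt_of_ne haf] at hZf
    have hZs' : ∀ t, t ≠ a → Z t ≠ 0 → Z t = X t ∨ Z t = Y t := fun t hta ht => by
      have := hZs t
      rw [zeroAt_of_ne hta] at this
      exact this ht
    by_cases hgood : Z a ≠ 0 → Z a = X a ∨ Z a = Y a
    · refine ⟨Z, hZ, hZe, hZf, fun t ht => ?_⟩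
      by_cases hta : t = a
      · subst hta; exact hgood ht
      · exact hZs' t hta ht
    · push Not at hgood
      obtain ⟨hZa, hZX, hZY⟩ := hgood
      have hZ₀a : Z₀ a = -Z a := by
        refine SignType.eq_neg_of_ne ha hZa fun h => ?_
        rcases hZ₀s a ha with h' | h'
        · exact hZX (h ▸ h')
        · exact hZY (h ▸ h')
      obtain ⟨W, hW, h1, h2, h3⟩ := ih _ (by
          rw [← hn]
          refine Set.ncard_lt_ncard (Set.ssubset_iff_exists.2 ⟨?_, e, Or.inl he, ?_⟩)
            (Set.toFinite _)
          · rintro t (ht | ht)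
            · by_cases hta : t = a
              · subst hta; exact haXY
              · rcases hZs' t hta ht with h | h
                · exact Or.inl (h.symm.trans_ne ht)
                · exact Or.inr (h.symm.trans_ne ht)
            · rcases hZ₀s t ht with h | h
              · exact Or.inl (h.symm.trans_ne ht)
              · exact Or.inr (h.symm.trans_ne ht)
          · rintro (h | h)
            · exact h hZe
            · exact h hZ₀e) hC hZ hZ₀ hZa hZ₀a (hZf ▸ hf)
          (by rw [hZ₀f, hZf]; exact fun h => hf (by simpa using h.symm)) rfl
      refine ⟨W, hW, ?_, h2.trans hZf, fun t ht => ?_⟩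
      · by_contra h0
        rcases h3 e h0 with h | h
        · exact h0 (h.trans hZe)
        · exact h0 (h.trans hZ₀e)
      · have hta : t ≠ a := by rintro rfl; exact ht h1
        rcases h3 t ht with h | h
        · exact h ▸ hZs' t hta (h ▸ ht)
        · exact h ▸ hZ₀s t (h ▸ ht)

end CircuitSystem

/-! ### Sign orthogonality and painting -/

section Painting

variable {S : Type*} {C : Set (S → SignType)}

lemma mul_eq_zero_of_mem_signPerp {y c : S → SignType} (hy : y ∈ signPerp C) (hc : c ∈ C)
    (h : ∀ s, 0 ≤ c s * y s) (s : S) : c s * y s = 0 := by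
  have hnn : ∀ a : SignType, 0 ≤ a → a ≠ -1 := by decide
  rcases SignType.trichotomy (c s * y s) with h' | h' | h'
  · exact absurd h' (hnn _ (h s))
  · exact h'
  · obtain ⟨t, ht⟩ := (hy c hc).1 ⟨s, h'⟩
    exact absurd ht (hnn _ (h t))

lemma IsCircuitSystem.mem_signPerp (hC : IsCircuitSystem C) {y : S → SignType}
    (h : ∀ c ∈ C, (∀ s, 0 ≤ c s * y s) → ∀ s, c s * y s = 0) : y ∈ signPerp C := by
  have hnn : ∀ a : SignType, a ≠ -1 → 0 ≤ a := by decide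
  have key : ∀ c ∈ C, (∃ s, c s * y s = 1) → ∃ s, c s * y s = -1 := by
    rintro c hc ⟨s, hs⟩
    by_contra hcon
    push Not at hcon
    have := h c hc (fun t => hnn _ (hcon t)) s
    rw [hs] at this
    exact absurd this (by decide)
  refine fun c hc => ⟨key c hc, ?_⟩
  rintro ⟨s, hs⟩
  obtain ⟨t, ht⟩ := key (-c) (hC.neg_mem c hc) ⟨s, by rw [Pi.neg_apply, neg_mul, hs]; rfl⟩
  refine ⟨t, ?_⟩
  rw [Pi.neg_apply, neg_mul] at ht
  rw [← neg_neg (c t * y t), ht]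
  rfl

lemma IsCircuitSystem.neg_mem_signPerp (hC : IsCircuitSystem C) {y : S → SignType}
    (hy : y ∈ signPerp C) : -y ∈ signPerp C := by
  refine hC.mem_signPerp fun c hc h s => ?_
  have h1 := mul_eq_zero_of_mem_signPerp hy (hC.neg_mem c hc) (fun t => by simpa using h t) s
  simpa using h1

/-- Circuits of the deletion of `D`. -/
def avoiding (C : Set (S → SignType)) (D : Set S) : Set (S → SignType) :=
  {c ∈ C | ∀ t ∈ D, c t = 0}

lemma IsCircuitSystem.avoiding (hC : IsCircuitSystem C) (D : Set S) :
    IsCircuitSystem (avoiding C D) where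
  zero_notMem h := hC.zero_notMem h.1
  neg_mem c hc := ⟨hC.neg_mem c hc.1, fun t ht => by simp [hc.2 t ht]⟩
  eq_or_eq_neg c hc c' hc' := hC.eq_or_eq_neg c hc.1 c' hc'.1
  elimination c hc c' hc' hne s hs hs' := by
    obtain ⟨d, hd, hds, hdt⟩ := hC.elimination c hc.1 c' hc'.1 hne s hs hs'
    refine ⟨d, ⟨hd, fun t ht => ?_⟩, hds, hdt⟩
    by_contra h0
    rcases hdt t h0 with h | h
    · exact h0 (h.trans (hc.2 t ht))
    · exact h0 (h.trans (hc'.2 t ht))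

/-- A covector of a single-element deletion extends to the deleted element. If all three signs
fail at `g`, then circuits witnessing the failure of `0` and of one of `±1` can be eliminated at
`g`, which contradicts orthogonality in the deletion. -/
lemma IsCircuitSystem.exists_extend_one [Finite S] (hC : IsCircuitSystem C) (g : S)
    {y : S → SignType} (hy : y ∈ signPerp (_root_.avoiding C {g})) :
    ∃ z ∈ signPerp C, ∀ t, t ≠ g → z t = y t := by
  classical
  by_contra hcon
  push Not at hcon
  have wit : ∀ v : SignType, ∃ c ∈ C, 0 ≤ c g * v ∧ (∀ t, t ≠ g → 0 ≤ c t * y t) ∧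
      c g ≠ 0 ∧ (v = 0 → ∃ w, w ≠ g ∧ c w * y w ≠ 0) := by
    intro v
    have hv : Function.update y g v ∉ signPerp C := fun h => by
      obtain ⟨t, ht, hne⟩ := hcon _ h
      exact hne (Function.update_of_ne ht _ _)
    have : ∃ c ∈ C, (∀ s, 0 ≤ c s * Function.update y g v s) ∧
        ∃ s, c s * Function.update y g v s ≠ 0 := by
      by_contra h
      push Not at h
      exact hv (hC.mem_signPerp h)
    obtain ⟨c, hc, hnn, w, hw⟩ := this
    have hnn' : ∀ t, t ≠ g → 0 ≤ c t * y t := fun t ht => by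
      have := hnn t
      rwa [Function.update_of_ne ht] at this
    refine ⟨c, hc, by simpa using hnn g, hnn', fun hcg => ?_, fun hv0 => ?_⟩
    · have hwg : w ≠ g := by
        rintro rfl
        exact hw (by rw [hcg, zero_mul])
      rw [Function.update_of_ne hwg] at hw
      refine hw (mul_eq_zero_of_mem_signPerp hy ⟨hc, by simpa using hcg⟩ (fun t => ?_) w)
      by_cases ht : t = g
      · rw [ht, hcg, zero_mul]
      · exact hnn' t ht
    · have hwg : w ≠ g := by
        rintro rfl
        exact hw (by simp [hv0])
      exact ⟨w, hwg, by rwa [Function.update_of_ne hwg] at hw⟩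
  obtain ⟨c₀, hc₀, -, h₀, hg₀, hw₀⟩ := wit 0
  obtain ⟨w, hwg, hw⟩ := hw₀ rfl
  obtain ⟨c₁, hc₁, h1, h1y, h1g⟩ : ∃ c₁ ∈ C, c₁ g = -c₀ g ∧ (∀ t, t ≠ g → 0 ≤ c₁ t * y t) ∧
      c₁ g ≠ 0 := by
    obtain ⟨c₁, hc₁, h1, h1y, h1g, -⟩ := wit (-c₀ g)
    refine ⟨c₁, hc₁, ?_, h1y, h1g⟩
    have : ∀ a b : SignType, a ≠ 0 → b ≠ 0 → 0 ≤ a * -b → a = -b := by decide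
    exact this _ _ h1g hg₀ h1
  have hwne : c₁ w ≠ -c₀ w := by
    have : ∀ a b y : SignType, 0 ≤ a * y → 0 ≤ b * y → b * y ≠ 0 → a ≠ -b := by decide
    exact this _ _ _ (h1y w hwg) (h₀ w hwg) hw
  obtain ⟨Z, hZ, hZg, hZw, hZt⟩ := hC.strong_elimination hc₀ hc₁ hg₀ h1
    (left_ne_zero_of_mul hw) hwne
  refine hw (hZw ▸ mul_eq_zero_of_mem_signPerp hy ⟨hZ, by simpa using hZg⟩ (fun t => ?_) w)
  by_cases hZ0 : Z t = 0
  · rw [hZ0, zero_mul]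
  · have htg : t ≠ g := by rintro rfl; exact hZ0 hZg
    rcases hZt t hZ0 with h | h <;> rw [h]
    · exact h₀ t htg
    · exact h1y t htg

lemma IsCircuitSystem.exists_extend [Finite S] (D : Set S) :
    ∀ {C : Set (S → SignType)}, IsCircuitSystem C → ∀ {y : S → SignType},
      y ∈ signPerp (_root_.avoiding C D) → ∃ z ∈ signPerp C, ∀ t, t ∉ D → z t = y t := by
  induction D, Set.toFinite D using Set.Finite.induction_on with
  | empty =>
    intro C hC y hy
    exact ⟨y, fun c hc => hy c ⟨hc, by simp⟩, fun _ _ => rfl⟩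
  | @insert g D _ _ ih =>
    intro C hC y hy
    obtain ⟨z, hz, hzt⟩ := (hC.avoiding D).exists_extend_one g (y := y) (fun c hc => hy c
      ⟨hc.1.1, by
        rintro t (rfl | ht)
        · exact hc.2 t rfl
        · exact hc.1.2 t ht⟩)
    obtain ⟨z', hz', hzt'⟩ := ih hC hz
    refine ⟨z', hz', fun t ht => ?_⟩
    rw [hzt' t (fun h => ht (Or.inr h)), hzt t (fun h => ht (Or.inl h))]

/-- The elements outside `R` that lie on no circuit that is nonnegative outside `R` and positive
there form the support of a nonnegative covector. -/
lemma IsCircuitSystem.exists_covector_of_forall [Finite S] (hC : IsCircuitSystem C) (R : Set S)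
    {w : S} (hw : w ∉ R) (h : ∀ c ∈ C, (∀ t, t ∉ R → 0 ≤ c t) → c w ≠ 1) :
    ∃ y ∈ signPerp C, y w = 1 ∧ (∀ t ∈ R, y t = 0) ∧ ∀ t, 0 ≤ y t := by
  classical
  let free : S → Prop := fun t => t ∉ R ∧ ∀ c ∈ C, (∀ u, u ∉ R → 0 ≤ c u) → c t ≠ 1
  refine ⟨fun t => if free t then 1 else 0, hC.mem_signPerp fun d hd hnn => ?_, ?_, ?_, ?_⟩
  · have main : ∀ n : ℕ, ∀ d ∈ C, {u | u ∉ R ∧ d u = -1}.ncard = n →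
        (∀ u, free u → 0 ≤ d u) → ∀ t, free t → d t ≠ 1 := by
      intro n
      induction n using Nat.strong_induction_on with
      | _ n ih =>
        intro d hd hn hdf t ht hdt
        by_cases hex : ∃ u, u ∉ R ∧ d u = -1
        · obtain ⟨u, huR, hu⟩ := hex
          have hnf : ¬ free u := fun hf => absurd (hdf u hf) (by rw [hu]; decide)
          have : ∃ c ∈ C, (∀ u, u ∉ R → 0 ≤ c u) ∧ c u = 1 := by
            by_contra hcon
            push Not at hcon
            exact hnf ⟨huR, hcon⟩
          obtain ⟨c, hc, hcR, hcu⟩ := this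
          have hct : c t ≠ -d t := by
            rw [hdt]
            intro h'
            exact absurd (hcR t ht.1) (by rw [h']; decide)
          obtain ⟨Z, hZ, hZu, hZt, hZs⟩ := hC.strong_elimination hd hc (e := u) (f := t)
            (by rw [hu]; decide) (by rw [hu, hcu]; rfl) (by rw [hdt]; decide) hct
          have hneg : ∀ v, v ∉ R → Z v = -1 → d v = -1 := fun v hv hZv => by
            rcases hZs v (by rw [hZv]; decide) with h' | h'
            · rw [← h', hZv]
            · exact absurd (hcR v hv) (by rw [← h', hZv]; decide)
          refine ih _ ?_ Z hZ rfl (fun v hv => ?_) t ht (hZt.trans hdt)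
          · rw [← hn]
            refine Set.ncard_lt_ncard (Set.ssubset_iff_exists.2 ⟨?_, u, ⟨huR, hu⟩, ?_⟩)
              (Set.toFinite _)
            · rintro v ⟨hv, hZv⟩
              exact ⟨hv, hneg v hv hZv⟩
            · rintro ⟨-, h'⟩
              rw [hZu] at h'
              exact absurd h' (by decide)
          · have hdec : ∀ a : SignType, a ≠ -1 → 0 ≤ a := by decide
            refine hdec _ fun hZv => ?_
            exact absurd (hdf v hv) (by rw [hneg v hv.1 hZv]; decide)
        · push Not at hex
          have hdec : ∀ a : SignType, a ≠ -1 → 0 ≤ a := by decide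
          exact ht.2 d hd (fun u hu => hdec _ (hex u hu)) hdt
    intro s
    by_cases hs : free s
    · have hdf : ∀ u, free u → 0 ≤ d u := fun u hu => by simpa [hu] using hnn u
      have hdec : ∀ a : SignType, 0 ≤ a → a ≠ 1 → a = 0 := by decide
      rw [hdec _ (hdf s hs) (main _ d hd rfl hdf s hs), zero_mul]
    · simp [hs]
  · exact if_pos ⟨hw, h⟩
  · exact fun t ht => if_neg fun h' => h'.1 ht
  · intro t
    dsimp only
    split_ifs
    · decide
    · exact le_rfl

/-- Painting lemma. Colour the elements of `R` free for circuits, those of `D` free for covectors,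
and ask for nonnegativity on all others. If no circuit that vanishes on `D` is positive at
`w`, then some covector that vanishes on `R` is. -/
theorem IsCircuitSystem.painting [Finite S] (hC : IsCircuitSystem C) (R D : Set S)
    {w : S} (hwR : w ∉ R) (hwD : w ∉ D)
    (h : ∀ c ∈ C, (∀ t ∈ D, c t = 0) → (∀ t, t ∉ R → 0 ≤ c t) → c w ≠ 1) :
    ∃ y ∈ signPerp C, y w = 1 ∧ (∀ t ∈ R, t ∉ D → y t = 0) ∧ ∀ t, t ∉ D → 0 ≤ y t := by
  obtain ⟨y, hy, hyw, hyR, hy0⟩ := (hC.avoiding D).exists_covector_of_forall R hwR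
    (fun c hc => h c hc.1 hc.2)
  obtain ⟨z, hz, hzt⟩ := IsCircuitSystem.exists_extend D hC hy
  exact ⟨z, hz, (hzt w hwD).trans hyw, fun t htR htD => (hzt t htD).trans (hyR t htR),
    fun t htD => (hzt t htD).symm ▸ hy0 t⟩

end Painting

/-! ### Flats and faces in terms of circuits -/

namespace OrientedMatroid

variable {S : Type*} {M : OrientedMatroid S}

/-- An element of the closure of `A` is contained in a circuit inside `A ∪ {e}`. -/
lemma exists_circuit_of_forall_isFlat [Finite S] {A : Set S} {e : S} (he : e ∉ A)
    (h : ∀ F, M.IsFlat F → A ⊆ F → e ∈ F) :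
    ∃ c ∈ M.circuits, c e = 1 ∧ ∀ t, c t ≠ 0 → t = e ∨ t ∈ A := by
  by_contra hcon
  push Not at hcon
  obtain ⟨y, hy, hye, hyA, -⟩ := M.isCircuitSystem.painting A {t | t ≠ e ∧ t ∉ A} he
    (by simp) (fun c hc hD _ hce => by
      obtain ⟨t, ht, hte, htA⟩ := hcon c hc hce
      exact ht (hD t ⟨hte, htA⟩))
  have := h {s | y s = 0} ⟨y, by rwa [M.covectors_eq], rfl⟩
    (fun t ht => hyA t ht (fun h' => h'.2 ht))
  rw [Set.mem_ofPred_eq, hye] at this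
  exact absurd this (by decide)

/-- A set is a flat if and only if no circuit leaves it in exactly one element. -/
lemma isFlat_iff [Finite S] {F : Set S} :
    M.IsFlat F ↔ ∀ c ∈ M.circuits, ∀ e, c e ≠ 0 → (∀ t, c t ≠ 0 → t = e ∨ t ∈ F) → e ∈ F := by
  constructor
  · rintro ⟨y, hy, rfl⟩ c hc e hce hcF
    rw [M.covectors_eq] at hy
    have hz : ∀ c ∈ M.circuits, (∀ t, c t ≠ 0 → t = e ∨ y t = 0) → 0 ≤ c e * y e →
        c e * y e = 0 := fun c hc hcF h0 =>
      mul_eq_zero_of_mem_signPerp hy hc (fun t => by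
        by_cases ht : c t = 0
        · rw [ht, zero_mul]
        · rcases hcF t ht with rfl | h'
          · exact h0
          · rw [h', mul_zero]) e
    have : c e * y e = 0 := by
      have hdec : ∀ a : SignType, 0 ≤ a ∨ 0 ≤ -a := by decide
      rcases hdec (c e * y e) with h0 | h0
      · exact hz c hc hcF h0
      · have := hz (-c) (M.neg_mem c hc) (fun t ht => hcF t (by simpa using ht)) (by simpa using h0)
        simpa using this
    exact (mul_eq_zero.1 this).resolve_left hce
  · intro h
    have hcl : M.IsFlat (⋂₀ {F' | M.IsFlat F' ∧ F ⊆ F'}) :=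
      sInter_closed IsFlat.univ (fun _ _ => IsFlat.inter) _ (fun F' hF' => hF'.1)
    convert hcl
    refine Set.Subset.antisymm (Set.subset_sInter fun F' hF' => hF'.2) fun e he => ?_
    by_contra heF
    obtain ⟨c, hc, hce, hct⟩ := exists_circuit_of_forall_isFlat heF
      (fun F' hF' hle => he F' ⟨hF', hle⟩)
    exact heF (h c hc e (by rw [hce]; decide) hct)

/-- A set is a face if and only if every circuit that leaves it takes both signs outside; as
circuits come in opposite pairs, it suffices to exclude one sign. -/
lemma isFace_iff {F : Set S} :
    M.IsFace F ↔ ∀ c ∈ M.circuits, (∀ t, t ∉ F → 0 ≤ c t) → ∀ t, t ∉ F → c t = 0 := by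
  classical
  constructor
  · rintro ⟨y, hy, hy0, rfl⟩ c hc h t ht
    rw [M.covectors_eq] at hy
    refine (mul_eq_zero.1 (mul_eq_zero_of_mem_signPerp hy hc (fun s => ?_) t)).resolve_right ht
    by_cases hs : y s = 0
    · rw [hs, mul_zero]
    · have hdec : ∀ a b : SignType, 0 ≤ a → 0 ≤ b → 0 ≤ a * b := by decide
      exact hdec _ _ (h s hs) (hy0 s)
  · intro h
    refine ⟨fun s => if s ∈ F then 0 else 1, ?_, fun s => ?_, ?_⟩
    · rw [M.covectors_eq]
      refine M.isCircuitSystem.mem_signPerp fun c hc hnn s => ?_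
      by_cases hs : s ∈ F
      · simp [hs]
      · have := h c hc (fun t ht => by simpa [ht] using hnn t) s hs
        rw [this, zero_mul]
    · dsimp only
      split_ifs
      · exact le_rfl
      · decide
    · ext s
      by_cases hs : s ∈ F <;> simp [hs]

lemma IsFace.isFlat {F : Set S} (h : M.IsFace F) : M.IsFlat F := by
  obtain ⟨x, hx, -, h⟩ := h
  exact ⟨x, hx, h⟩

lemma IsAcyclic.isFace_empty (hM : M.IsAcyclic) : M.IsFace ∅ :=
  isFace_iff.2 fun c hc h => absurd ⟨c, hc, fun s => h s (by simp)⟩ hM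

/-- Moving from a positive covector on `X \ X₀` towards `z` until a boundary is met: a covector `z`
that takes a negative value on `X` is replaced by one with fewer negative values on `X`, positive
at `e` and with a zero in `X \ X₀`, until it is nonnegative on `X`. -/
lemma exists_nonneg_covector [Finite S] {X₀ X : Set S} (hX₀ : M.IsFace X₀) {e : S} (heX : e ∈ X)
    (heX₀ : e ∉ X₀) :
    ∀ n : ℕ, ∀ z ∈ M.covectors, {v | v ∈ X ∧ z v = -1}.ncard = n → (∀ t ∈ X₀, t ∈ X → z t = 0) →
      0 ≤ z e → (∃ s ∈ X, z s = -1) →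
      ∃ y ∈ M.covectors, y e = 1 ∧ (∀ t ∈ X₀, t ∈ X → y t = 0) ∧ (∀ t ∈ X, 0 ≤ y t) ∧
        ∃ s ∈ X, s ∉ X₀ ∧ y s = 0 := by
  have hdec : ∀ a : SignType, a ≠ -1 → 0 ≤ a := by decide
  intro n
  induction n using Nat.strong_induction_on with
  | _ n ih =>
    rintro z hz hn hzX₀ hze ⟨s, hsX, hs⟩
    have hsX₀ : s ∉ X₀ := fun h => by
      have := hzX₀ s h hsX
      rw [hs] at this
      exact absurd this (by decide)
    have hse : e ≠ s := by
      rintro rfl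
      rw [hs] at hze
      exact absurd hze (by decide)
    have hneg : ∀ a : SignType, 0 ≤ a → a ≠ -1 := by decide
    obtain ⟨y, hy, hye, hyR, hyD⟩ := M.isCircuitSystem.painting (insert s X₀)
      {t | t ∉ X ∨ (z t = -1 ∧ t ≠ s)} (w := e) (by simp [hse, heX₀])
      (by simp [heX, hneg _ hze]) (by
        -- such a circuit would be nonnegative off the face `X₀` unless it is negative at `s`,
        -- and then it would not be orthogonal to `z`
        intro c hc hD hR hce
        by_cases hcs : 0 ≤ c s
        · have := isFace_iff.1 hX₀ c hc (fun t ht => by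
            by_cases hts : t = s
            · rwa [hts]
            · exact hR t (by simp [hts, ht])) e heX₀
          rw [hce] at this
          exact absurd this (by decide)
        · have hcs' : c s = -1 := by
            by_contra h'
            exact hcs (hdec _ h')
          rw [M.covectors_eq] at hz
          have := mul_eq_zero_of_mem_signPerp hz hc (fun t => ?_) s
          · rw [hcs', hs] at this
            exact absurd this (by decide)
          by_cases htD : t ∉ X ∨ (z t = -1 ∧ t ≠ s)
          · rw [hD t htD, zero_mul]
          push Not at htD
          by_cases hts : t = s
          · rw [hts, hcs', hs]; decide
          by_cases htX₀ : t ∈ X₀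
          · rw [hzX₀ t htX₀ htD.1, mul_zero]
          have h1 : ∀ a b : SignType, 0 ≤ a → 0 ≤ b → 0 ≤ a * b := by decide
          exact h1 _ _ (hR t (by simp [hts, htX₀])) (hdec _ fun h' => hts (htD.2 h')))
    rw [← M.covectors_eq] at hy
    have hyX₀ : ∀ t ∈ X₀, t ∈ X → y t = 0 := fun t ht htX => hyR t (Or.inr ht) (by
      rintro (h' | ⟨h', -⟩)
      · exact h' htX
      · rw [hzX₀ t ht htX] at h'
        exact absurd h' (by decide))
    have hys : y s = 0 := hyR s (Or.inl rfl) (by simp [hsX])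
    by_cases hex : ∃ s ∈ X, y s = -1
    · refine ih _ ?_ y hy rfl hyX₀ (by rw [hye]; decide) hex
      rw [← hn]
      refine Set.ncard_lt_ncard (Set.ssubset_iff_exists.2 ⟨?_, s, ⟨hsX, hs⟩, ?_⟩)
        (Set.toFinite _)
      · rintro v ⟨hvX, hv⟩
        refine ⟨hvX, by_contra fun h' => ?_⟩
        refine hneg _ (hyD v ?_) hv
        rintro (h'' | h'')
        · exact h'' hvX
        · exact h' h''.1
      · rintro ⟨-, h'⟩
        rw [hys] at h'
        exact absurd h' (by decide)
    · push Not at hex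
      exact ⟨y, hy, hye, hyX₀, fun t ht => hdec _ (hex t ht), s, hsX, hsX₀, hys⟩

/-- If no face lies strictly between the faces `X₀ ⊂ X`, then any two elements of `X \ X₀` are
parallel modulo `X₀`: the face lattice has the same rank function as the lattice of flats. -/
lemma exists_circuit_of_covBy [Finite S] {X₀ X : Set S} (hX₀ : M.IsFace X₀) (hX : M.IsFace X)
    (hsub : X₀ ⊆ X) (hcov : ∀ X', M.IsFace X' → X₀ ⊆ X' → X' ⊆ X → X' = X₀ ∨ X' = X)
    {e t : S} (he : e ∈ X) (he₀ : e ∉ X₀) (ht : t ∈ X) (ht₀ : t ∉ X₀) (het : e ≠ t) :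
    ∃ c ∈ M.circuits, c e ≠ 0 ∧ c t ≠ 0 ∧ ∀ u, c u ≠ 0 → u = e ∨ u = t ∨ u ∈ X₀ := by
  by_cases hcl : ∀ F, M.IsFlat F → insert e X₀ ⊆ F → t ∈ F
  · obtain ⟨c, hc, hct, hcs⟩ := exists_circuit_of_forall_isFlat (by simp [het.symm, ht₀]) hcl
    have hct0 : c t ≠ 0 := by rw [hct]; decide
    refine ⟨c, hc, fun hce => ?_, hct0, fun u hu => ?_⟩
    · refine ht₀ (isFlat_iff.1 hX₀.isFlat c hc t hct0 fun u hu => ?_)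
      rcases hcs u hu with h | rfl | h
      · exact Or.inl h
      · exact absurd hce hu
      · exact Or.inr h
    · rcases hcs u hu with h | h | h
      · exact Or.inr (Or.inl h)
      · exact Or.inl h
      · exact Or.inr (Or.inr h)
  · exfalso
    push Not at hcl
    obtain ⟨_, ⟨y, hy, rfl⟩, hle, hyt⟩ := hcl
    have hyt' : y t ≠ 0 := hyt
    have : ∃ z ∈ M.covectors, (∀ u ∈ insert e X₀, z u = 0) ∧ z t = -1 := by
      rcases SignType.trichotomy (y t) with h | h | h
      · exact ⟨y, hy, hle, h⟩
      · exact absurd h hyt'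
      · refine ⟨-y, ?_, fun u hu => ?_, by rw [Pi.neg_apply, h]⟩
        · rw [M.covectors_eq] at hy ⊢
          exact M.isCircuitSystem.neg_mem_signPerp hy
        · have h0 : y u = 0 := hle hu
          rw [Pi.neg_apply, h0]; rfl
    obtain ⟨z, hz, hz0, hzt⟩ := this
    obtain ⟨v, hv, hve, hvX₀, hvX, s, hsX, hsX₀, hvs⟩ := exists_nonneg_covector hX₀ he he₀ _ z hz
      rfl (fun u hu _ => hz0 u (Or.inr hu)) (hz0 e (Or.inl rfl)).ge ⟨t, ht, hzt⟩
    obtain ⟨x, hx, hx0, hxX⟩ := hX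
    have hxX' : ∀ u, x u = 0 ↔ u ∈ X := fun u => by rw [hxX]; rfl
    have hface : M.IsFace {u | (if x u = 0 then v u else x u) = 0} :=
      ⟨_, comp_mem_covectors hx hv, fun u => by
        split_ifs with hu
        · exact hvX u ((hxX' u).1 hu)
        · exact hx0 u, rfl⟩
    have hmem : ∀ u, u ∈ {u | (if x u = 0 then v u else x u) = 0} ↔ u ∈ X ∧ v u = 0 := fun u => by
      rw [← hxX', Set.mem_ofPred_eq]
      by_cases hu : x u = 0 <;> simp [hu]
    rcases hcov _ hface (fun u hu => (hmem u).2 ⟨hsub hu, hvX₀ u hu (hsub hu)⟩)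
      (fun u hu => ((hmem u).1 hu).1) with h | h
    · exact hsX₀ (h ▸ (hmem s).2 ⟨hsX, hvs⟩)
    · have := ((hmem e).1 (h.symm ▸ he)).2
      rw [hve] at this
      exact absurd this (by decide)

end OrientedMatroid

/-! ### Product decompositions of lower intervals -/

section Lattice

variable {L : Type*} [CompleteLattice L]

/-- The lower interval of `Y` is the product of the lower intervals of the members of `J`: every
element below `Y` is the join of its parts below the members of `J`, and parts can be prescribed
independently. -/
structure IsProductAt (J : Set L) (Y : L) : Prop where
  le_iSup_inf : ∀ Z ≤ Y, Z ≤ ⨆ j : J, Z ⊓ j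
  iSup_inf_le : ∀ X : J → L, (∀ j, X j ≤ j) → ∀ i : J, (⨆ j, X j) ⊓ i ≤ X i

open Classical in
lemma isProductAt_iff {J : Set L} {Y : L} (hJ : ∀ j ∈ J, j ≤ Y) :
    IsProductAt J Y ↔ ∃ φ : (∀ j : J, Set.Iic (j : L)) ≃o Set.Iic Y,
      ∀ (j : J) (X : Set.Iic (j : L)), (φ (Function.update ⊥ j X) : L) = (X : L) := by
  constructor
  · rintro ⟨h1, h2⟩
    have h2' : ∀ (X : ∀ j : J, Set.Iic (j : L)) (i : J), (⨆ j, (X j : L)) ⊓ i = X i := fun X i =>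
      le_antisymm (h2 (fun j => X j) (fun j => (X j).2) i) (le_inf (le_iSup (fun j => (X j : L)) i)
        (X i).2)
    refine ⟨⟨⟨fun X => ⟨⨆ j, (X j : L), iSup_le fun j => (X j).2.trans (hJ j j.2)⟩,
      fun Z j => ⟨Z ⊓ j, inf_le_right⟩, fun X => ?_, fun Z => ?_⟩, ?_⟩, ?_⟩
    · funext j
      exact Subtype.ext (h2' X j)
    · exact Subtype.ext (le_antisymm (iSup_le fun j => inf_le_left) (h1 Z Z.2))
    · intro X X'
      constructor
      · intro h j
        have h' : (⨆ j, (X j : L)) ≤ ⨆ j, (X' j : L) := h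
        change (X j : L) ≤ X' j
        rw [← h2' X j, ← h2' X' j]
        exact inf_le_inf_right _ h'
      · exact fun h => iSup_mono fun j => h j
    · intro j X
      refine le_antisymm (iSup_le fun i => ?_) ?_
      · by_cases hij : i = j
        · subst hij
          simp
        · rw [Function.update_of_ne hij]
          exact bot_le
      · refine le_trans ?_ (le_iSup _ j)
        simp
  · rintro ⟨φ, hφ⟩
    -- the inverse of `φ` takes the meet with each member of `J`
    have key : ∀ (W : ∀ j : J, Set.Iic (j : L)) (j : J) (X : L), X ≤ j →
        (X ≤ W j ↔ X ≤ (φ W : L)) := by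
      intro W j X hX
      have h : Function.update ⊥ j ⟨X, hX⟩ ≤ W ↔
          φ (Function.update ⊥ j ⟨X, hX⟩) ≤ φ W := φ.le_iff_le.symm
      rw [← Subtype.coe_le_coe (x := φ _), hφ] at h
      rw [← h, update_le_iff]
      simp [← Subtype.coe_le_coe]
    have hsup : ∀ W : ∀ j : J, Set.Iic (j : L), (φ W : L) = ⨆ j, (W j : L) := by
      intro W
      refine le_antisymm ?_ (iSup_le fun j => (key W j _ (W j).2).1 le_rfl)
      have hle : (⨆ j, (W j : L)) ≤ Y := iSup_le fun j => (W j).2.trans (hJ j j.2)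
      have : W ≤ φ.symm ⟨_, hle⟩ := fun j => by
        refine Subtype.coe_le_coe.1 ((key _ j _ (W j).2).2 ?_)
        rw [OrderIso.apply_symm_apply]
        exact le_iSup (fun j => (W j : L)) j
      have := φ.monotone this
      rw [OrderIso.apply_symm_apply] at this
      exact this
    refine ⟨fun Z hZ => ?_, fun X hX i => ?_⟩
    · have h := hsup (φ.symm ⟨Z, hZ⟩)
      rw [OrderIso.apply_symm_apply] at h
      refine h.le.trans (iSup_mono fun j => le_inf ?_ (φ.symm ⟨Z, hZ⟩ j).2)
      have := (key (φ.symm ⟨Z, hZ⟩) j _ (φ.symm ⟨Z, hZ⟩ j).2).1 le_rfl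
      rwa [OrderIso.apply_symm_apply] at this
    · refine (key (fun j => ⟨X j, hX j⟩) i _ inf_le_right).2 ?_
      rw [hsup]
      exact inf_le_left

lemma isBuildingSet_iff {B : Set L} :
    IsBuildingSet B ↔ ⊥ ∉ B ∧ ∀ Y : L, Y ≠ ⊥ → IsProductAt (maxBelow B Y) Y := by
  unfold IsBuildingSet
  refine and_congr_right fun _ => forall_congr' fun Y => imp_congr_right fun _ => ?_
  rw [isProductAt_iff fun j hj => hj.1.2]

lemma eq_of_mem_maxBelow {B : Set L} {b c Y : L} (hb : b ∈ maxBelow B Y) (hc : c ∈ B)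
    (hcY : c ≤ Y) (hbc : b ≤ c) : b = c :=
  le_antisymm hbc (hb.2 ⟨hc, hcY⟩ hbc)

open Classical in
lemma IsProductAt.disjoint {J : Set L} {Y : L} (h : IsProductAt J Y) {i j : J} (hij : i ≠ j) :
    (i : L) ⊓ j ≤ ⊥ := by
  have h0 := h.iSup_inf_le (Function.update (fun _ => ⊥) i (i : L)) (fun k => by
    by_cases hk : k = i
    · subst hk; simp
    · rw [Function.update_of_ne hk]; exact bot_le) j
  rw [Function.update_of_ne hij.symm] at h0
  refine (inf_le_inf_right _ ?_).trans h0
  have := le_iSup (Function.update (fun _ : J => (⊥ : L)) i (i : L)) i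
  rwa [Function.update_self] at this

open Classical in
/-- Below `i`, a join that contains all the other members of `J` keeps only the part `X`
prescribed there. -/
lemma IsProductAt.sup_inf_le {J : Set L} {Y : L} (h : IsProductAt J Y) (i : J) {X : L}
    (hX : X ≤ i) : (X ⊔ ⨆ j : {j : J // j ≠ i}, (j.1 : L)) ⊓ i ≤ X := by
  have := h.iSup_inf_le (Function.update (fun j : J => (j : L)) i X) (fun j => by
    by_cases hji : j = i
    · subst hji; simpa using hX
    · rw [Function.update_of_ne hji]) i
  rw [Function.update_self] at this
  refine (inf_le_inf_right _ (sup_le ?_ (iSup_le fun j => ?_))).trans this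
  · have := le_iSup (Function.update (fun j : J => (j : L)) i X) i
    rwa [Function.update_self] at this
  · have := le_iSup (Function.update (fun j : J => (j : L)) i X) j
    rwa [Function.update_of_ne j.2] at this

lemma exists_le_maxBelow [Finite L] {B : Set L} {b Y : L} (hb : b ∈ B) (hbY : b ≤ Y) :
    ∃ j ∈ maxBelow B Y, b ≤ j := by
  obtain ⟨j, hbj, hj⟩ := (Set.toFinite {x | x ∈ B ∧ x ≤ Y}).exists_le_maximal
    (show b ∈ {x | x ∈ B ∧ x ≤ Y} from ⟨hb, hbY⟩)
  exact ⟨j, hj, hbj⟩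

end Lattice

/-! ### Splittings of flats and faces -/

namespace OrientedMatroid

variable {S : Type*} {M : OrientedMatroid S}

/-- The restriction of the oriented matroid to `Y` is the direct sum of its restrictions to the
members of the family `J`: these are disjoint and cover `Y`, and every circuit inside `Y` lies
inside one of them. -/
structure Splits (M : OrientedMatroid S) {ι : Type*} (Y : Set S) (J : ι → Set S) : Prop where
  subset : ∀ j, J j ⊆ Y
  cover : ∀ s ∈ Y, ∃ j, s ∈ J j
  disjoint : ∀ i j s, s ∈ J i → s ∈ J j → i = j
  circuit : ∀ c ∈ M.circuits, Function.support c ⊆ Y → ∃ j, Function.support c ⊆ J j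

lemma exists_ne_zero {c : S → SignType} (hc : c ∈ M.circuits) : ∃ s, c s ≠ 0 := by
  by_contra h
  push Not at h
  exact M.zero_notMem ((funext h : c = 0) ▸ hc)

variable {ι : Type*} {Y : Set S} {J : ι → Set S}

lemma Splits.iUnion_subset (h : M.Splits Y J) {X : ι → Set S} (hXJ : ∀ j, X j ⊆ J j) :
    ⋃ j, X j ⊆ Y :=
  Set.iUnion_subset fun j => (hXJ j).trans (h.subset j)

lemma Splits.mem_of_mem_iUnion (h : M.Splits Y J) {X : ι → Set S} (hXJ : ∀ j, X j ⊆ J j)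
    {s : S} (hs : s ∈ ⋃ j, X j) {j : ι} (hsj : s ∈ J j) : s ∈ X j := by
  obtain ⟨i, hi⟩ := Set.mem_iUnion.1 hs
  obtain rfl := h.disjoint i j s (hXJ i hi) hsj
  exact hi

/-- Inside a split flat, a union of flats of the parts is a flat. -/
lemma Splits.isFlat_iUnion [Finite S] (h : M.Splits Y J) (hY : M.IsFlat Y) {X : ι → Set S}
    (hX : ∀ j, M.IsFlat (X j)) (hXJ : ∀ j, X j ⊆ J j) : M.IsFlat (⋃ j, X j) := by
  refine isFlat_iff.2 fun c hc e hce hct => ?_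
  have hYX := h.iUnion_subset hXJ
  have heY : e ∈ Y := isFlat_iff.1 hY c hc e hce fun t ht => (hct t ht).imp_right (@hYX t)
  obtain ⟨j, hcj⟩ := h.circuit c hc fun t ht => by
    rcases hct t ht with rfl | h'
    · exact heY
    · exact hYX h'
  refine Set.mem_iUnion.2 ⟨j, isFlat_iff.1 (hX j) c hc e hce fun t ht => ?_⟩
  exact (hct t ht).imp_right fun h' => h.mem_of_mem_iUnion hXJ h' (hcj ht)

/-- A circuit that is nonnegative outside a subset `X` of a split face lies in one of the parts,
if it is not inside `X`. -/
lemma Splits.exists_support_subset (h : M.Splits Y J) (hY : M.IsFace Y) {X : Set S} (hXY : X ⊆ Y)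
    {c : S → SignType} (hc : c ∈ M.circuits) (hnn : ∀ t, t ∉ X → 0 ≤ c t) :
    ∃ j, Function.support c ⊆ J j :=
  h.circuit c hc fun t ht => by_contra fun h' =>
    ht (isFace_iff.1 hY c hc (fun u hu => hnn u fun hu' => hu (hXY hu')) t h')

/-- Inside a split face, a union of faces of the parts is a face. -/
lemma Splits.isFace_iUnion (h : M.Splits Y J) (hY : M.IsFace Y) {X : ι → Set S}
    (hX : ∀ j, M.IsFace (X j)) (hXJ : ∀ j, X j ⊆ J j) : M.IsFace (⋃ j, X j) := by
  refine isFace_iff.2 fun c hc hnn t ht => ?_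
  obtain ⟨j, hcj⟩ := h.exists_support_subset hY (h.iUnion_subset hXJ) hc hnn
  refine isFace_iff.1 (hX j) c hc (fun u hu => ?_) t fun h' => ht (Set.mem_iUnion.2 ⟨j, h'⟩)
  by_cases hcu : c u = 0
  · exact hcu.ge
  · exact hnn u fun h' => hu (h.mem_of_mem_iUnion hXJ h' (hcj hcu))

/-- In an acyclic oriented matroid the parts of a split face are faces. -/
lemma Splits.isFace (hM : M.IsAcyclic) (h : M.Splits Y J) (hY : M.IsFace Y) (j : ι) :
    M.IsFace (J j) := by
  refine isFace_iff.2 fun c hc hnn t ht => ?_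
  obtain ⟨i, hci⟩ := h.exists_support_subset hY (h.subset j) hc hnn
  by_contra hct
  refine hM ⟨c, hc, fun u => ?_⟩
  by_cases hcu : c u = 0
  · exact hcu.ge
  · refine hnn u fun huj => ht ?_
    obtain rfl := h.disjoint i j u (hci hcu) huj
    exact hci hct

section Finite

variable [Finite S]

instance : Finite M.FlatLattice := inferInstanceAs (Finite {F : Set S // M.IsFlat F})

instance : Finite M.FaceLattice := inferInstanceAs (Finite {F : Set S // M.IsFace F})

lemma mem_flat_inf {X Y : M.FlatLattice} {s : S} : s ∈ (X ⊓ Y).1 ↔ s ∈ X.1 ∧ s ∈ Y.1 := by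
  refine ⟨fun h => ⟨(inf_le_left : X ⊓ Y ≤ X) h, (inf_le_right : X ⊓ Y ≤ Y) h⟩, fun h => ?_⟩
  let Z : M.FlatLattice := ⟨X.1 ∩ Y.1, X.2.inter Y.2⟩
  have hX : Z ≤ X := (Set.inter_subset_left : X.1 ∩ Y.1 ⊆ X.1)
  have hY : Z ≤ Y := (Set.inter_subset_right : X.1 ∩ Y.1 ⊆ Y.1)
  exact le_inf hX hY h

lemma mem_face_inf {X Y : M.FaceLattice} {s : S} : s ∈ (X ⊓ Y).1 ↔ s ∈ X.1 ∧ s ∈ Y.1 := by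
  refine ⟨fun h => ⟨(inf_le_left : X ⊓ Y ≤ X) h, (inf_le_right : X ⊓ Y ≤ Y) h⟩, fun h => ?_⟩
  let Z : M.FaceLattice := ⟨X.1 ∩ Y.1, X.2.inter Y.2⟩
  have hX : Z ≤ X := (Set.inter_subset_left : X.1 ∩ Y.1 ⊆ X.1)
  have hY : Z ≤ Y := (Set.inter_subset_right : X.1 ∩ Y.1 ⊆ Y.1)
  exact le_inf hX hY h

lemma IsAcyclic.flat_bot (hM : M.IsAcyclic) : (⊥ : M.FlatLattice).1 = ∅ :=
  Set.subset_empty_iff.1 (show (⊥ : M.FlatLattice) ≤ ⟨∅, hM.isFace_empty.isFlat⟩ from bot_le)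

lemma IsAcyclic.face_bot (hM : M.IsAcyclic) : (⊥ : M.FaceLattice).1 = ∅ :=
  Set.subset_empty_iff.1 (show (⊥ : M.FaceLattice) ≤ ⟨∅, hM.isFace_empty⟩ from bot_le)

/-- There are no loops. -/
lemma IsAcyclic.exists_ne_of_mem_circuits (hM : M.IsAcyclic) {c : S → SignType}
    (hc : c ∈ M.circuits) {s : S} (hs : c s ≠ 0) : ∃ t, t ≠ s ∧ c t ≠ 0 := by
  by_contra hno
  push Not at hno
  exact isFlat_iff.1 hM.isFace_empty.isFlat c hc s hs fun t ht =>
    Or.inl (by_contra fun hts => ht (hno t hts))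

/-- The closure of a set, as an element of the lattice of flats. -/
noncomputable def closure (M : OrientedMatroid S) (A : Set S) : M.FlatLattice :=
  sInf {F | A ⊆ F.1}

lemma subset_closure (A : Set S) : A ⊆ (M.closure A).1 :=
  Set.subset_sInter (by rintro _ ⟨F, hF, rfl⟩; exact hF)

lemma closure_le {A : Set S} {F : M.FlatLattice} (h : A ⊆ F.1) : M.closure A ≤ F := sInf_le h

lemma exists_circuit_of_mem_closure {A : Set S} {e : S} (he : e ∉ A)
    (h : e ∈ (M.closure A).1) :
    ∃ c ∈ M.circuits, c e = 1 ∧ ∀ t, c t ≠ 0 → t = e ∨ t ∈ A :=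
  exists_circuit_of_forall_isFlat he fun F hF hAF =>
    (closure_le (F := ⟨F, hF⟩) hAF : (M.closure A).1 ⊆ F) h

/-- In the lattice of flats, splittings are product decompositions. -/
lemma Splits.isProductAt_flat {Y : M.FlatLattice} {J : Set M.FlatLattice}
    (h : M.Splits Y.1 (fun j : J => j.1.1)) : IsProductAt J Y := by
  refine ⟨fun Z hZ s hs => ?_, fun X hX i s hs => ?_⟩
  · obtain ⟨j, hsj⟩ := h.cover s (hZ hs)
    exact (le_iSup (fun j : J => Z ⊓ j.1) j) (mem_flat_inf.2 ⟨hs, hsj⟩)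
  · have hle : (⨆ j, X j) ≤
        (⟨_, h.isFlat_iUnion Y.2 (fun j => (X j).2) hX⟩ : M.FlatLattice) :=
      iSup_le fun j => Set.subset_iUnion (fun j => (X j).1) j
    have hs' := mem_flat_inf.1 hs
    exact h.mem_of_mem_iUnion hX (hle hs'.1) hs'.2

/-- In the face lattice, splittings into faces are product decompositions. -/
lemma Splits.isProductAt_face {Y : M.FaceLattice} {J : Set M.FaceLattice}
    (h : M.Splits Y.1 (fun j : J => j.1.1)) : IsProductAt J Y := by
  refine ⟨fun Z hZ s hs => ?_, fun X hX i s hs => ?_⟩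
  · obtain ⟨j, hsj⟩ := h.cover s (hZ hs)
    exact (le_iSup (fun j : J => Z ⊓ j.1) j) (mem_face_inf.2 ⟨hs, hsj⟩)
  · have hle : (⨆ j, X j) ≤
        (⟨_, h.isFace_iUnion Y.2 (fun j => (X j).2) hX⟩ : M.FaceLattice) :=
      iSup_le fun j => Set.subset_iUnion (fun j => (X j).1) j
    have hs' := mem_face_inf.1 hs
    exact h.mem_of_mem_iUnion hX (hle hs'.1) hs'.2

/-- A product decomposition of a lower interval in the lattice of flats is a splitting. -/
lemma IsAcyclic.splits_of_isProductAt_flat (hM : M.IsAcyclic) {Y : M.FlatLattice}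
    {J : Set M.FlatLattice} (hJ : ∀ j ∈ J, j ≤ Y) (h : IsProductAt J Y) :
    M.Splits Y.1 (fun j : J => j.1.1) := by
  -- the closure of `s` is the join of its parts, and all its elements are parallel to `s`, so a
  -- nonempty part contains `s`
  have hcover : ∀ s ∈ Y.1, ∃ j : J, s ∈ j.1.1 := by
    intro s hs
    by_contra hcon
    push Not at hcon
    have hsZ : s ∈ (M.closure {s}).1 := subset_closure _ rfl
    have hle := h.le_iSup_inf (M.closure {s}) (closure_le (by simpa using hs)) hsZ
    have hle' : (⨆ j : J, M.closure {s} ⊓ j) ≤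
        M.closure (⋃ j : J, (M.closure {s} ⊓ j.1).1) :=
      iSup_le fun j => (Set.subset_iUnion (fun j : J => (M.closure {s} ⊓ j.1).1) j).trans
        (subset_closure _)
    obtain ⟨c, hc, hcs, hct⟩ := exists_circuit_of_mem_closure (fun hmem => by
      obtain ⟨j, hj⟩ := Set.mem_iUnion.1 hmem
      exact hcon j (mem_flat_inf.1 hj).2) (hle' hle)
    -- the circuit has a further element `t`, which is parallel to `s`
    obtain ⟨t, hts, ht⟩ := hM.exists_ne_of_mem_circuits hc (s := s) (by rw [hcs]; decide)
    obtain ⟨j, hj⟩ := Set.mem_iUnion.1 ((hct t ht).resolve_left hts)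
    have hj' := mem_flat_inf.1 hj
    obtain ⟨d, hd, hdt, hds⟩ := exists_circuit_of_mem_closure (A := {s}) (by simpa using hts)
      hj'.1
    obtain ⟨u, hut, hu⟩ := hM.exists_ne_of_mem_circuits hd (s := t) (by rw [hdt]; decide)
    obtain rfl : u = s := (hds u hu).resolve_left hut
    exact hcon j (isFlat_iff.1 j.1.2 d hd u hu fun v hv => by
      rcases hds v hv with rfl | h'
      · exact Or.inr hj'.2
      · exact Or.inl h')
  refine ⟨fun j => hJ j.1 j.2, hcover, fun i j s hsi hsj => ?_, fun c hc hcY => ?_⟩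
  · by_contra hij
    have hmem : s ∈ (⊥ : M.FlatLattice).1 := h.disjoint hij (mem_flat_inf.2 ⟨hsi, hsj⟩)
    rw [hM.flat_bot] at hmem
    exact hmem
  · obtain ⟨e, he⟩ := exists_ne_zero hc
    obtain ⟨j, hej⟩ := hcover e (hcY he)
    refine ⟨j, ?_⟩
    -- `e` is in the closure of the rest of the circuit, and only the part `A` of the rest that
    -- lies in the same member of `J` matters
    set A : Set S := {t | c t ≠ 0 ∧ t ∈ j.1.1 ∧ t ≠ e}
    set Z : M.FlatLattice := M.closure A ⊔ ⨆ i : {i : J // i ≠ j}, (i.1 : M.FlatLattice)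
    have heZ : e ∈ Z.1 := by
      refine isFlat_iff.1 Z.2 c hc e he fun t ht => ?_
      by_cases hte : t = e
      · exact Or.inl hte
      right
      by_cases htj : t ∈ j.1.1
      · exact (le_sup_left : M.closure A ≤ Z) (subset_closure A ⟨ht, htj, hte⟩)
      · obtain ⟨i, hti⟩ := hcover t (hcY ht)
        have hij : i ≠ j := by
          rintro rfl
          exact htj hti
        have : i.1 ≤ Z := le_sup_of_le_right (le_iSup
          (fun i : {i : J // i ≠ j} => (i.1 : M.FlatLattice)) ⟨i, hij⟩)
        exact this hti
    have hecl : e ∈ (M.closure A).1 :=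
      h.sup_inf_le j (closure_le fun t ht => ht.2.1) (mem_flat_inf.2 ⟨heZ, hej⟩)
    obtain ⟨d, hd, hde, hdt⟩ := exists_circuit_of_mem_closure (fun h' => h'.2.2 rfl) hecl
    have hdc : Function.support d ⊆ Function.support c := fun t ht => by
      rcases hdt t ht with rfl | h'
      · exact he
      · exact h'.1
    have hdj : Function.support d ⊆ j.1.1 := fun t ht => by
      rcases hdt t ht with rfl | h'
      · exact hej
      · exact h'.2.1
    rcases M.eq_or_eq_neg d hd c hc hdc with rfl | rfl
    · exact hdj
    · rwa [SignType.support_neg] at hdj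

end Finite

end OrientedMatroid

/-! ### Product decompositions in the face lattice -/

namespace OrientedMatroid

variable {S : Type*} {M : OrientedMatroid S} [Finite S]

/-- If `X ∪ Q` is a face for every face `X ⊆ P`, then `P` and `Q` do not share circuits. Along a
maximal chain of faces below `X`, a circuit that meets the top layer and `Q` can be shortened by
elimination with a circuit that has exactly two elements in that layer. -/
lemma support_subset_or_of_isFace_union (hM : M.IsAcyclic) {P Q : Set S} (hPQ : Disjoint P Q)
    (hU : ∀ X, M.IsFace X → X ⊆ P → M.IsFace (X ∪ Q)) {X : Set S} (hX : M.IsFace X)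
    (hXP : X ⊆ P) {c : S → SignType} (hc : c ∈ M.circuits) (hcX : Function.support c ⊆ X ∪ Q) :
    Function.support c ⊆ X ∨ Function.support c ⊆ Q := by
  induction hn : X.ncard using Nat.strong_induction_on generalizing X c with
  | _ n ih =>
    rcases X.eq_empty_or_nonempty with rfl | hne
    · exact Or.inr (by simpa using hcX)
    have hfin : {X' : Set S | M.IsFace X' ∧ X' ⊂ X}.Finite := Set.toFinite _
    obtain ⟨X₀, hX₀⟩ := hfin.exists_maximal
      ⟨∅, hM.isFace_empty, Set.ssubset_iff_subset_ne.2 ⟨Set.empty_subset _, hne.ne_empty.symm⟩⟩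
    obtain ⟨hX₀f, hlt⟩ := hX₀.1
    have hcov : ∀ X', M.IsFace X' → X₀ ⊆ X' → X' ⊆ X → X' = X₀ ∨ X' = X := by
      intro X' hX' h1 h2
      by_cases h : X' = X
      · exact Or.inr h
      · exact Or.inl (Set.Subset.antisymm
          (hX₀.2 ⟨hX', Set.ssubset_iff_subset_ne.2 ⟨h2, h⟩⟩ h1) h1)
    have hQ : ∀ s, s ∈ X → s ∉ Q := fun s hs hs' => Set.disjoint_left.1 hPQ (hXP hs) hs'
    induction hm : {t | c t ≠ 0 ∧ t ∈ X ∧ t ∉ X₀}.ncard using Nat.strong_induction_on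
      generalizing c with
    | _ m ihm =>
      by_contra hcon
      push Not at hcon
      obtain ⟨q, hq, hqX⟩ := Set.not_subset.1 hcon.1
      by_cases hex : ∃ e, c e ≠ 0 ∧ e ∈ X ∧ e ∉ X₀
      swap
      · push Not at hex
        have hc₀ : Function.support c ⊆ X₀ ∪ Q := fun t ht =>
          (hcX ht).imp_left (hex t ht)
        rcases ih _ (hn ▸ Set.ncard_lt_ncard hlt (Set.toFinite _)) hX₀f (hlt.1.trans hXP) hc hc₀
          rfl with h | h
        · exact hcon.1 (h.trans hlt.1)
        · exact hcon.2 h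
      obtain ⟨e, hce, heX, heX₀⟩ := hex
      obtain ⟨t, hte, hct, htX, htX₀⟩ : ∃ t, t ≠ e ∧ c t ≠ 0 ∧ t ∈ X ∧ t ∉ X₀ := by
        by_contra hno
        push Not at hno
        rcases isFlat_iff.1 (hU X₀ hX₀f (hlt.1.trans hXP)).isFlat c hc e hce fun t ht => by
          by_cases hte : t = e
          · exact Or.inl hte
          · exact Or.inr ((hcX ht).imp_left (hno t hte ht)) with h | h
        · exact heX₀ h
        · exact hQ e heX h
      obtain ⟨d, hd, hde, hdX⟩ : ∃ d ∈ M.circuits, d e = -c e ∧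
          ∀ u, d u ≠ 0 → u = e ∨ u = t ∨ u ∈ X₀ := by
        obtain ⟨d, hd, hde, -, hdX⟩ := exists_circuit_of_covBy hX₀f hX hlt.1 hcov heX heX₀ htX htX₀
          hte.symm
        by_cases h : d e = -c e
        · exact ⟨d, hd, h, hdX⟩
        · refine ⟨-d, M.neg_mem d hd, ?_, fun u hu => hdX u (by simpa using hu)⟩
          have : ∀ a b : SignType, a ≠ 0 → b ≠ 0 → a ≠ -b → -a = -b := by decide
          exact this _ _ hde hce h
      have hdX' : ∀ u, d u ≠ 0 → u ∈ X := fun u hu => by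
        rcases hdX u hu with rfl | rfl | h
        · exact heX
        · exact htX
        · exact hlt.1 h
      have hdq : d q = 0 := by_contra fun h => hqX (hdX' q h)
      obtain ⟨Z, hZ, hZe, hZq, hZs⟩ := M.isCircuitSystem.strong_elimination hc hd hce hde hq
        (by rw [hdq]; intro h; exact hq (by simpa using h.symm))
      have hZcd : ∀ u, Z u ≠ 0 → c u ≠ 0 ∨ d u ≠ 0 := fun u hu =>
        (hZs u hu).imp (fun h => h.symm.trans_ne hu) (fun h => h.symm.trans_ne hu)
      rcases ihm _ (by
          rw [← hm]
          refine Set.ncard_lt_ncard (Set.ssubset_iff_exists.2 ⟨?_, e, ⟨hce, heX, heX₀⟩, ?_⟩)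
            (Set.toFinite _)
          · rintro u ⟨hu, huX, huX₀⟩
            refine ⟨?_, huX, huX₀⟩
            rcases hZcd u hu with h | h
            · exact h
            · rcases hdX u h with rfl | rfl | h
              · exact hce
              · exact hct
              · exact absurd h huX₀
          · exact fun h => h.1 hZe) hZ (fun u hu => (hZcd u hu).elim (fun h => hcX h)
            fun h => Or.inl (hdX' u h)) rfl with h | h
      · exact hqX (h (show Z q ≠ 0 from hZq ▸ hq))
      · rcases M.eq_or_eq_neg Z hZ c hc (fun u hu =>
          (hZcd u hu).resolve_right fun h' => hQ u (hdX' u h') (h hu)) with rfl | rfl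
        · exact hce hZe
        · exact hce (by simpa using hZe)

/-- A product decomposition of a lower interval in the face lattice is a splitting, if all
singletons are faces. -/
lemma IsAcyclic.splits_of_isProductAt_face (hM : M.IsAcyclic) (hS : ∀ s, M.IsFace {s})
    {Y : M.FaceLattice} {J : Set M.FaceLattice} (hJ : ∀ j ∈ J, j ≤ Y) (h : IsProductAt J Y) :
    M.Splits Y.1 (fun j : J => j.1.1) := by
  have hcover : ∀ s ∈ Y.1, ∃ j : J, s ∈ j.1.1 := by
    intro s hs
    by_contra hcon
    push Not at hcon
    let A : M.FaceLattice := ⟨{s}, hS s⟩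
    have hAY : A ≤ Y := Set.singleton_subset_iff.2 hs
    have hle : (⨆ j : J, A ⊓ j) ≤ ⊥ := iSup_le fun j t ht => by
      have ht' := mem_face_inf.1 ht
      obtain rfl : t = s := ht'.1
      exact absurd ht'.2 (hcon j)
    have hmem : s ∈ (⊥ : M.FaceLattice).1 := hle (h.le_iSup_inf A hAY rfl)
    rw [hM.face_bot] at hmem
    exact hmem
  refine ⟨fun j => hJ j.1 j.2, hcover, fun i j s hsi hsj => ?_, fun c hc hcY => ?_⟩
  · by_contra hij
    have hmem : s ∈ (⊥ : M.FaceLattice).1 := h.disjoint hij (mem_face_inf.2 ⟨hsi, hsj⟩)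
    rw [hM.face_bot] at hmem
    exact hmem
  · obtain ⟨e, he⟩ := exists_ne_zero hc
    obtain ⟨j, hej⟩ := hcover e (hcY he)
    refine ⟨j, ?_⟩
    have hU : ∀ X, M.IsFace X → X ⊆ j.1.1 → M.IsFace (X ∪ (Y.1 \ j.1.1)) := by
      intro X hX hXj
      let A : M.FaceLattice := ⟨X, hX⟩
      have hAj : A ≤ j.1 := hXj
      let Z : M.FaceLattice := A ⊔ ⨆ i : {i : J // i ≠ j}, (i.1 : M.FaceLattice)
      have hZY : Z ≤ Y := sup_le (hAj.trans (hJ j.1 j.2)) (iSup_le fun i => hJ _ i.1.2)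
      convert Z.2
      refine Set.Subset.antisymm (Set.union_subset (le_sup_left : A ≤ Z) ?_) ?_
      · rintro s ⟨hsY, hsj⟩
        obtain ⟨i, hi⟩ := hcover s hsY
        have hij : i ≠ j := by
          rintro rfl
          exact hsj hi
        have : i.1 ≤ Z := le_sup_of_le_right (le_iSup
          (fun i : {i : J // i ≠ j} => (i.1 : M.FaceLattice)) ⟨i, hij⟩)
        exact this hi
      · intro s hs
        by_cases hsj : s ∈ j.1.1
        · exact Or.inl (h.sup_inf_le j hAj (mem_face_inf.2 ⟨hs, hsj⟩))
        · exact Or.inr ⟨hZY hs, hsj⟩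
    rcases support_subset_or_of_isFace_union hM Set.disjoint_sdiff_right hU j.1.2 subset_rfl hc
      (fun t ht => by
        by_cases htj : t ∈ j.1.1
        · exact Or.inl htj
        · exact Or.inr ⟨hcY ht, htj⟩) with h' | h'
    · exact h'
    · exact absurd hej (h' he).2

/-! ### Building sets of flats -/

lemma IsAcyclic.splits_maxBelow_flat (hM : M.IsAcyclic) {G : Set M.FlatLattice}
    (hG : IsBuildingSet G) {Y : M.FlatLattice} (hY : Y ≠ ⊥) :
    M.Splits Y.1 (fun j : maxBelow G Y => j.1.1) :=
  hM.splits_of_isProductAt_flat (fun _ hj => hj.1.2) ((isBuildingSet_iff.1 hG).2 Y hY)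

lemma IsAcyclic.splits_maxBelow_face (hM : M.IsAcyclic) (hS : ∀ s, M.IsFace {s})
    {F : Set M.FaceLattice} (hF : IsBuildingSet F) {Y : M.FaceLattice} (hY : Y ≠ ⊥) :
    M.Splits Y.1 (fun j : maxBelow F Y => j.1.1) :=
  hM.splits_of_isProductAt_face hS (fun _ hj => hj.1.2) ((isBuildingSet_iff.1 hF).2 Y hY)

lemma IsAcyclic.flat_ne_bot (hM : M.IsAcyclic) {Y : M.FlatLattice} {s : S} (hs : s ∈ Y.1) :
    Y ≠ ⊥ := by
  rintro rfl
  rw [hM.flat_bot] at hs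
  exact hs

/-- A set of nonempty flats is a building set if and only if it contains the closures of the
elements and of the circuits, and the join of any two of its members that intersect. In
particular, intersections of building sets are building sets. -/
lemma IsAcyclic.isBuildingSet_flat_iff (hM : M.IsAcyclic) {G : Set M.FlatLattice} :
    IsBuildingSet G ↔ ⊥ ∉ G ∧ (∀ s, M.closure {s} ∈ G) ∧
      (∀ c ∈ M.circuits, M.closure (Function.support c) ∈ G) ∧
      ∀ X ∈ G, ∀ Y ∈ G, ∀ s, s ∈ X.1 → s ∈ Y.1 → X ⊔ Y ∈ G := by
  constructor
  · intro hG
    have hcl : ∀ A : Set S, ∀ j : maxBelow G (M.closure A), A ⊆ j.1.1 → M.closure A ∈ G := by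
      intro A j hj
      have : M.closure A = j.1 := le_antisymm (closure_le hj) j.2.1.2
      exact this ▸ j.2.1.1
    refine ⟨hG.1, fun s => ?_, fun c hc => ?_, fun X hX Y hY s hsX hsY => ?_⟩
    · have hs := subset_closure (M := M) {s} rfl
      obtain ⟨j, hj⟩ := (hM.splits_maxBelow_flat hG (hM.flat_ne_bot hs)).cover s hs
      exact hcl _ j (by simpa using hj)
    · obtain ⟨s, hs⟩ := exists_ne_zero hc
      have hs' := subset_closure (M := M) (Function.support c) hs
      obtain ⟨j, hj⟩ := (hM.splits_maxBelow_flat hG (hM.flat_ne_bot hs')).circuit c hc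
        (subset_closure _)
      exact hcl _ j hj
    · have hs : s ∈ (X ⊔ Y).1 := (le_sup_left : X ≤ X ⊔ Y) hsX
      have hsplit := hM.splits_maxBelow_flat hG (hM.flat_ne_bot hs)
      obtain ⟨i, hi, hXi⟩ := exists_le_maxBelow hX (le_sup_left : X ≤ X ⊔ Y)
      obtain ⟨j, hj, hYj⟩ := exists_le_maxBelow hY (le_sup_right : Y ≤ X ⊔ Y)
      have hij : i = j := congrArg Subtype.val
        (hsplit.disjoint ⟨i, hi⟩ ⟨j, hj⟩ s (hXi hsX) (hYj hsY))
      have : X ⊔ Y = i := le_antisymm (sup_le hXi (hij ▸ hYj)) hi.1.2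
      exact this ▸ hi.1.1
  · rintro ⟨hbot, hs, hc, hsup⟩
    refine isBuildingSet_iff.2 ⟨hbot, fun Y _ => Splits.isProductAt_flat
      ⟨fun j => j.2.1.2, fun s hsY => ?_, fun i j s hsi hsj => ?_, fun c hcc hcY => ?_⟩⟩
    · obtain ⟨j, hj, hle⟩ := exists_le_maxBelow (hs s)
        (closure_le (Set.singleton_subset_iff.2 hsY) : _ ≤ Y)
      exact ⟨⟨j, hj⟩, hle (subset_closure _ rfl)⟩
    · have hmem := hsup _ i.2.1.1 _ j.2.1.1 s hsi hsj
      have hle : i.1 ⊔ j.1 ≤ Y := sup_le i.2.1.2 j.2.1.2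
      have h1 := eq_of_mem_maxBelow i.2 hmem hle le_sup_left
      have h2 := eq_of_mem_maxBelow j.2 hmem hle le_sup_right
      exact Subtype.ext (h1.trans h2.symm)
    · obtain ⟨j, hj, hle⟩ := exists_le_maxBelow (hc c hcc) (closure_le hcY : _ ≤ Y)
      exact ⟨⟨j, hj⟩, (subset_closure _).trans hle⟩

lemma IsAcyclic.isBuildingSet_ne_bot (hM : M.IsAcyclic) :
    IsBuildingSet {Z : M.FlatLattice | Z ≠ ⊥} := by
  refine hM.isBuildingSet_flat_iff.2 ⟨fun h => h rfl, fun s => ?_, fun c hc => ?_,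
    fun X _ Y _ s hs _ => ?_⟩
  · exact hM.flat_ne_bot (subset_closure {s} rfl)
  · obtain ⟨s, hs⟩ := exists_ne_zero hc
    exact hM.flat_ne_bot (subset_closure (Function.support c) hs)
  · exact hM.flat_ne_bot ((le_sup_left : X ≤ X ⊔ Y) hs)

lemma IsAcyclic.isBuildingSet_buildingClosure (hM : M.IsAcyclic) {X : Set M.FlatLattice}
    (hX : ⊥ ∉ X) : IsBuildingSet (buildingClosure X) := by
  have key := fun (G : Set M.FlatLattice) (hG : IsBuildingSet G ∧ X ⊆ G) =>
    hM.isBuildingSet_flat_iff.1 hG.1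
  refine hM.isBuildingSet_flat_iff.2 ⟨fun h => ?_, fun s G hG => (key G hG).2.1 s,
    fun c hc G hG => (key G hG).2.2.1 c hc,
    fun A hA B hB s hsA hsB G hG => (key G hG).2.2.2 A (hA G hG) B (hB G hG) s hsA hsB⟩
  exact h _ ⟨hM.isBuildingSet_ne_bot, fun x hx h0 => hX (h0 ▸ hx)⟩ rfl

/-! ### Restricting a building set of flats to the faces -/

lemma IsAcyclic.faceToFlat_bot (hM : M.IsAcyclic) : M.faceToFlat ⊥ = ⊥ :=
  le_bot_iff.1 fun s hs => by
    have : s ∈ (⊥ : M.FaceLattice).1 := hs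
    rw [hM.face_bot] at this
    exact absurd this (Set.notMem_empty s)

lemma faceToFlat_top : M.faceToFlat ⊤ = ⊤ := by
  let A : M.FaceLattice := ⟨Set.univ, IsFace.univ⟩
  have hA : A ≤ ⊤ := le_top
  exact top_le_iff.1 fun s _ => hA (Set.mem_univ s)

lemma blockComponents_eq_maxBelow_top {L : Type*} [CompleteLattice L] (B : Set L) :
    blockComponents B = maxBelow B ⊤ := by
  simp [blockComponents, maxBelow]

/-- The maximal members of a flatial building set below a face are faces. -/
lemma IsAcyclic.exists_faceToFlat_eq (hM : M.IsAcyclic) {G : Set M.FlatLattice}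
    (hG : IsBuildingSet G) {Y : M.FaceLattice} {b : M.FlatLattice}
    (hb : b ∈ maxBelow G (M.faceToFlat Y)) : ∃ b', M.faceToFlat b' = b := by
  have hY : M.faceToFlat Y ≠ ⊥ := fun h =>
    hG.1 (le_bot_iff.1 (hb.1.2.trans h.le) ▸ hb.1.1)
  have := (hM.splits_maxBelow_flat hG hY).isFace hM Y.2 ⟨b, hb⟩
  exact ⟨⟨b.1, this⟩, rfl⟩

lemma IsAcyclic.mem_maxBelow_preimage (hM : M.IsAcyclic) {G : Set M.FlatLattice}
    (hG : IsBuildingSet G) {Y j : M.FaceLattice} :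
    j ∈ maxBelow (M.faceToFlat ⁻¹' G) Y ↔ M.faceToFlat j ∈ maxBelow G (M.faceToFlat Y) := by
  constructor
  · intro hj
    have hjY : M.faceToFlat j ≤ M.faceToFlat Y := M.faceToFlat.monotone hj.1.2
    obtain ⟨b, hb, hjb⟩ := exists_le_maxBelow (show M.faceToFlat j ∈ G from hj.1.1) hjY
    obtain ⟨b, rfl⟩ := hM.exists_faceToFlat_eq hG hb
    have := eq_of_mem_maxBelow hj hb.1.1 (M.faceToFlat.le_iff_le.1 hb.1.2)
      (M.faceToFlat.le_iff_le.1 hjb)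
    exact this ▸ hb
  · intro hj
    refine ⟨⟨hj.1.1, M.faceToFlat.le_iff_le.1 hj.1.2⟩, fun k hk hjk => ?_⟩
    exact M.faceToFlat.le_iff_le.1 (hj.2 ⟨hk.1, M.faceToFlat.monotone hk.2⟩
      (M.faceToFlat.monotone hjk))

lemma IsAcyclic.isBuildingSet_preimage (hM : M.IsAcyclic) {G : Set M.FlatLattice}
    (hG : IsBuildingSet G) : IsBuildingSet (M.faceToFlat ⁻¹' G) := by
  refine isBuildingSet_iff.2 ⟨fun h => hG.1 (hM.faceToFlat_bot ▸ h), fun Y hY => ?_⟩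
  have hY' : M.faceToFlat Y ≠ ⊥ := fun h =>
    hY (M.faceToFlat.injective (h.trans hM.faceToFlat_bot.symm))
  have hsplit := hM.splits_maxBelow_flat hG hY'
  have lift : ∀ b : maxBelow G (M.faceToFlat Y),
      ∃ j : maxBelow (M.faceToFlat ⁻¹' G) Y, M.faceToFlat j.1 = b.1 := fun b => by
    obtain ⟨j, hj⟩ := hM.exists_faceToFlat_eq hG b.2
    exact ⟨⟨j, (hM.mem_maxBelow_preimage hG).2 (hj ▸ b.2)⟩, hj⟩
  refine Splits.isProductAt_face ⟨fun j => j.2.1.2, fun s hs => ?_, fun i j s hsi hsj => ?_,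
    fun c hc hcY => ?_⟩
  · obtain ⟨b, hb⟩ := hsplit.cover s hs
    obtain ⟨j, hj⟩ := lift b
    exact ⟨j, (hj ▸ hb : s ∈ (M.faceToFlat j.1).1)⟩
  · have := hsplit.disjoint ⟨_, (hM.mem_maxBelow_preimage hG).1 i.2⟩
      ⟨_, (hM.mem_maxBelow_preimage hG).1 j.2⟩ s hsi hsj
    exact Subtype.ext (M.faceToFlat.injective (congrArg Subtype.val this))
  · obtain ⟨b, hb⟩ := hsplit.circuit c hc hcY
    obtain ⟨j, hj⟩ := lift b
    exact ⟨j, (hj ▸ hb : Function.support c ⊆ (M.faceToFlat j.1).1)⟩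

/-- If the join of faces in the lattice of flats belongs to `G`, it lies in a block below the join
`Y` in the face lattice; this block is a face, hence equal to `Y`. -/
lemma IsAcyclic.nestedComplex_map_le (hM : M.IsAcyclic) {G : Set M.FlatLattice}
    (hG : IsBuildingSet G) [DecidableEq M.FlatLattice] :
    (nestedComplex (M.faceToFlat ⁻¹' G)).map M.faceToFlat ≤ nestedComplex G := by
  classical
  have hκ : M.faceToFlat '' blockComponents (M.faceToFlat ⁻¹' G) = blockComponents G := by
    rw [blockComponents_eq_maxBelow_top, blockComponents_eq_maxBelow_top]
    ext b
    constructor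
    · rintro ⟨j, hj, rfl⟩
      rw [← faceToFlat_top]
      exact (hM.mem_maxBelow_preimage hG).1 hj
    · intro hb
      rw [← faceToFlat_top] at hb
      obtain ⟨j, rfl⟩ := hM.exists_faceToFlat_eq hG hb
      exact ⟨j, (hM.mem_maxBelow_preimage hG).2 hb, rfl⟩
  rintro _ ⟨σ, ⟨hσ, N, ⟨hNF, hκN, hN⟩, hσN⟩, rfl⟩
  refine ⟨hσ.image _, M.faceToFlat '' N, ⟨Set.image_subset_iff.2 hNF, ?_, ?_⟩, ?_⟩
  · rw [← hκ]
    exact Set.image_mono hκN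
  · rw [← hκ, ← Set.image_sdiff M.faceToFlat.injective]
    intro A hA hcard hanti hmem
    obtain ⟨A', hA', rfl⟩ := Finset.subset_set_image_iff.1 hA
    rw [Finset.card_image_of_injective _ M.faceToFlat.injective] at hcard
    refine hN A' hA' hcard ?_ ?_
    · intro x hx y hy hxy hle
      exact hanti (by simpa using hx) (by simpa using hy) (M.faceToFlat.injective.ne hxy)
        (M.faceToFlat.monotone hle)
    · set Y := A'.sup id with hY
      have hle : (A'.image M.faceToFlat).sup id ≤ M.faceToFlat Y := Finset.sup_le fun b hb => by
        obtain ⟨a, ha, rfl⟩ := Finset.mem_image.1 hb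
        exact M.faceToFlat.monotone (Finset.le_sup (f := id) ha)
      obtain ⟨b, hb, hle'⟩ := exists_le_maxBelow hmem hle
      obtain ⟨b, rfl⟩ := hM.exists_faceToFlat_eq hG hb
      have hYb : Y ≤ b := Finset.sup_le fun a ha => M.faceToFlat.le_iff_le.1
        ((Finset.le_sup (f := id) (Finset.mem_image_of_mem _ ha)).trans hle')
      have : Y = b := le_antisymm hYb (M.faceToFlat.le_iff_le.1 hb.1.2)
      exact this ▸ hb.1.1
  · rw [← hκ, ← Set.image_sdiff M.faceToFlat.injective, ← hσN, Finset.coe_image]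

/-! ### Extending a building set of faces to the flats -/

/-- The nonempty flats that lie, for every face `Y` containing them, in a single block below `Y`.
This is a building set of flats whose faces are exactly the members of `F`. -/
def blockFlats (F : Set M.FaceLattice) : Set M.FlatLattice :=
  {Z | Z ≠ ⊥ ∧ ∀ Y, Z ≤ M.faceToFlat Y → ∃ b ∈ maxBelow F Y, Z ≤ M.faceToFlat b}

lemma IsAcyclic.isBuildingSet_blockFlats (hM : M.IsAcyclic) (hS : ∀ s, M.IsFace {s})
    {F : Set M.FaceLattice} (hF : IsBuildingSet F) : IsBuildingSet (blockFlats F) := by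
  have hsplit : ∀ (Y : M.FaceLattice) (s : S), s ∈ Y.1 →
      M.Splits Y.1 (fun j : maxBelow F Y => j.1.1) := fun Y s hs =>
    hM.splits_maxBelow_face hS hF (by
      rintro rfl
      rw [hM.face_bot] at hs
      exact hs)
  refine hM.isBuildingSet_flat_iff.2 ⟨fun h => h.1 rfl, fun s => ?_, fun c hc => ?_,
    fun X hX X' hX' s hsX hsX' => ?_⟩
  · have hs := subset_closure (M := M) {s} rfl
    refine ⟨hM.flat_ne_bot hs, fun Y hY => ?_⟩
    obtain ⟨j, hj⟩ := (hsplit Y s (hY hs)).cover s (hY hs)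
    exact ⟨j, j.2, closure_le (Set.singleton_subset_iff.2 hj)⟩
  · obtain ⟨s, hs⟩ := exists_ne_zero hc
    have hs' := subset_closure (M := M) (Function.support c) hs
    refine ⟨hM.flat_ne_bot hs', fun Y hY => ?_⟩
    obtain ⟨j, hj⟩ := (hsplit Y s (hY hs')).circuit c hc ((subset_closure _).trans hY)
    exact ⟨j, j.2, closure_le hj⟩
  · refine ⟨hM.flat_ne_bot ((le_sup_left : X ≤ X ⊔ X') hsX), fun Y hY => ?_⟩
    have hXY : X ≤ M.faceToFlat Y := le_sup_left.trans hY
    obtain ⟨i, hi, hXi⟩ := hX.2 Y hXY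
    obtain ⟨j, hj, hXj⟩ := hX'.2 Y (le_sup_right.trans hY)
    have hij : i = j := congrArg Subtype.val
      ((hsplit Y s (hXY hsX)).disjoint ⟨i, hi⟩ ⟨j, hj⟩ s (hXi hsX) (hXj hsX'))
    exact ⟨i, hi, sup_le hXi (hij ▸ hXj)⟩

lemma IsAcyclic.image_subset_blockFlats (hM : M.IsAcyclic) {F : Set M.FaceLattice}
    (hF : ⊥ ∉ F) : M.faceToFlat '' F ⊆ blockFlats F := by
  rintro _ ⟨Z, hZ, rfl⟩
  refine ⟨fun h => hF (M.faceToFlat.injective (h.trans hM.faceToFlat_bot.symm) ▸ hZ),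
    fun Y hY => ?_⟩
  obtain ⟨b, hb, hle⟩ := exists_le_maxBelow hZ (M.faceToFlat.le_iff_le.1 hY)
  exact ⟨b, hb, M.faceToFlat.monotone hle⟩

lemma preimage_blockFlats_subset (F : Set M.FaceLattice) :
    M.faceToFlat ⁻¹' blockFlats F ⊆ F := by
  intro Z hZ
  obtain ⟨b, hb, hle⟩ := hZ.2 Z le_rfl
  have : Z = b := le_antisymm (M.faceToFlat.le_iff_le.1 hle) hb.1.2
  exact this ▸ hb.1.1

lemma IsAcyclic.preimage_buildingClosure (hM : M.IsAcyclic) (hS : ∀ s, M.IsFace {s})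
    {F : Set M.FaceLattice} (hF : IsBuildingSet F) :
    M.faceToFlat ⁻¹' buildingClosure (M.faceToFlat '' F) = F := by
  refine Set.Subset.antisymm (fun Z hZ => ?_) (fun Z hZ G hG => hG.2 ⟨Z, hZ, rfl⟩)
  exact preimage_blockFlats_subset F
    (hZ _ ⟨hM.isBuildingSet_blockFlats hS hF, hM.image_subset_blockFlats hF.1⟩)

end OrientedMatroid

open Classical in
theorem mainTheorem7 {S : Type*} [Finite S] (M : OrientedMatroid S) (hM : M.IsAcyclic) :
    (∀ G : Set M.FlatLattice, IsBuildingSet G →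
      IsBuildingSet (M.faceToFlat ⁻¹' G) ∧
      (nestedComplex (M.faceToFlat ⁻¹' G)).map M.faceToFlat ≤ nestedComplex G) ∧
    ((∀ s : S, M.IsFace {s}) →
      ∀ F : Set M.FaceLattice, IsBuildingSet F →
        IsLeast {G : Set M.FlatLattice | IsBuildingSet G ∧ M.faceToFlat '' F ⊆ G}
          (buildingClosure (M.faceToFlat '' F)) ∧
        M.faceToFlat ⁻¹' buildingClosure (M.faceToFlat '' F) = F ∧
        (nestedComplex F).map M.faceToFlat ≤
          nestedComplex (buildingClosure (M.faceToFlat '' F))) := by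
  refine ⟨fun G hG => ⟨hM.isBuildingSet_preimage hG, hM.nestedComplex_map_le hG⟩,
    fun hS F hF => ?_⟩
  have hbot : ⊥ ∉ M.faceToFlat '' F := by
    rintro ⟨Z, hZ, h⟩
    exact hF.1 (M.faceToFlat.injective (h.trans hM.faceToFlat_bot.symm) ▸ hZ)
  have hcl := hM.isBuildingSet_buildingClosure hbot
  have hpre := hM.preimage_buildingClosure hS hF
  refine ⟨⟨⟨hcl, Set.subset_sInter fun G hG => hG.2⟩, fun G hG => Set.sInter_subset_of_mem hG⟩,
    hpre, ?_⟩
  have := hM.nestedComplex_map_le hcl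
  rwa [hpre] at this
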